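/- Let $V\subset\mathbb R^d$ be a bounded measurable set, write $\langle g\rangle=\int_V g(v)\,dv$, and let $\mathbf m=(m_0,\dots,m_N)$ be measurable basis functions on $V$ with $\|m_i\|_{L^\infty(V)}\le 1$ for all $i$ and $m_0\equiv 1$, linearly independent in the sense that $\mathbf c\cdot\mathbf m=0$ a.e. on $V$ only for $\mathbf c=0$. Let $\eta\in C^3((0,\infty))$ with $\eta''>0$, let $\eta_*(y)=\sup_{z>0}(yz-\eta(z))$ be its Legendre dual, and assume that $\eta$ is superlinear, i.e. $\operatorname{range}(\eta')=\operatorname{dom}(\eta_*)=\mathbb R$. For $\alpha\in\mathbb R^{N+1}$ put $G_\alpha=\eta_*'(\alpha\cdot\mathbf m)$ and $\hat{\mathbf u}(\alpha)=\langle \mathbf m\,G_\alpha\rangle$, and for $M>0$ let $\mathcal R^M=\{\hat{\mathbf u}(\alpha):\|\alpha\|\le M\}$. For $\gamma\ge 0$ let $$\hat\alpha_\gamma(\mathbf u)=\operatorname*{argmax}_{\alpha\in\mathbb R^{N+1}}\Big\{\alpha\cdot\mathbf u-\langle\eta_*(\alpha\cdot\mathbf m)\rangle-\tfrac{\gamma}{2}\|\alpha\|^2\Big\},\qquad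 \mathbf f_\gamma(\mathbf u)=\langle v\,\mathbf m\,G_{\hat\alpha_\gamma(\mathbf u)}\rangle\in\mathbb R^{d\times(N+1)},$$ write $\mathbf f=\mathbf f_0$, and for $\gamma>0$ let $$h_\gamma(\mathbf u)=\langle\eta(G_{\hat\alpha_\gamma(\mathbf u)})\rangle+\tfrac1{2\gamma}\big\|\langle\mathbf m\,G_{\hat\alpha_\gamma(\mathbf u)}\rangle-\mathbf u\big\|^2 .$$ Define the relative entropy, the relative flux and the flux defect by $$h_\gamma(\mathbf w|\mathbf u)=h_\gamma(\mathbf w)-h_\gamma(\mathbf u)-\hat\alpha_\gamma(\mathbf u)\cdot(\mathbf w-\mathbf u),$$ $$\mathbf f_\gamma(\mathbf w|\mathbf u)=\mathbf f_\gamma(\mathbf w)-\mathbf f_\gamma(\mathbf u)-\mathbf f_\gamma'(\mathbf u)(\mathbf w-\mathbf u),$$ $$J_\gamma(\mathbf w,\mathbf u)=(\mathbf w-\mathbf u)\,h_\gamma''(\mathbf u)\,\big(\mathbf f'(\mathbf u)-\mathbf f_\gamma'(\mathbf u)\big)\in\mathbb R^{d\times(N+1)},$$ that is, $J_\gamma(\mathbf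 w,\mathbf u)_{kj}=\sum_i\big(h_\gamma''(\mathbf u)(\mathbf w-\mathbf u)\big)_i\,\partial_{u_j}(\mathbf f-\mathbf f_\gamma)_{ki}(\mathbf u)$. All norms are Euclidean (Frobenius for matrices). Let $M>0$ and $\gamma_0>0$. Then these objects are well defined: for $\gamma>0$ the maximizer $\hat\alpha_\gamma(\mathbf w)$ exists and is unique for every $\mathbf w\in\mathbb R^{N+1}$, and at every $\mathbf u\in\mathcal R^M$ the maximizer $\hat\alpha_0(\mathbf u)$ exists and is unique, $\mathbf f$ and $\mathbf f_\gamma$ are differentiable, and $h_\gamma$ is $C^2$. Moreover, there are positive constants $C_{\mathbf f}$, $C_J$, $D_J$, independent of $\mathbf u_\gamma$, $\mathbf u$ and $\gamma$, such that $$\|\mathbf f_\gamma(\mathbf u_\gamma|\mathbf u)\|\le C_{\mathbf f}\,h_\gamma(\mathbf u_\gamma|\mathbf u),\qquad \|J_\gamma(\mathbf u_\gamma,\mathbf u)\|\le C_J\,h_\gamma(\mathbf u_\gamma|\mathbf u)+D_J\gamma^2$$ for all $\mathbf u_\gamma\in\mathbb R^{N+1}$, $\mathbf u\in\mathcal R^M$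 and $\gamma\in(0,\gamma_0)$. -/

import Mathlib

open Set MeasureTheory

noncomputable section

namespace EntropyMoments

/-- The Legendre dual (convex conjugate) `η_*(y) = sup_{z > 0} (y z - η z)` of an entropy `η` on
`(0, ∞)`. -/
def legendreDual (η : ℝ → ℝ) (y : ℝ) : ℝ :=
  sSup ((fun z => y * z - η z) '' Ioi 0)

/-- The set of `y` at which the supremum defining `η_*(y)` is finite. -/
def legendreDom (η : ℝ → ℝ) : Set ℝ :=
  {y | BddAbove ((fun z => y * z - η z) '' Ioi 0)}

/-- A superlinear kinetic entropy function on `(0, ∞)`. Only the values of `η` on `(0, ∞)`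
matter. -/
structure IsSuperlinearEntropy (η : ℝ → ℝ) : Prop where
  contDiffOn : ContDiffOn ℝ 3 η (Ioi 0)
  deriv_deriv_pos : ∀ z : ℝ, 0 < z → 0 < deriv (deriv η) z
  range_deriv : deriv η '' Ioi 0 = univ
  dom_legendreDual : legendreDom η = univ

/-- The standing assumptions on the velocity set `V ⊆ ℝ^d` and the basis functions
`m_0, …, m_N` on `V`. -/
structure IsMomentBasis {d N : ℕ} (V : Set (EuclideanSpace ℝ (Fin d)))
    (m : Fin (N + 1) → EuclideanSpace ℝ (Fin d) → ℝ) : Prop where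
  measurableSet : MeasurableSet V
  isBounded : Bornology.IsBounded V
  aemeasurable : ∀ i, AEMeasurable (m i) (volume.restrict V)
  abs_le_one : ∀ i, ∀ᵐ v ∂(volume.restrict V), |m i v| ≤ 1
  zero_eq_one : ∀ᵐ v ∂(volume.restrict V), m 0 v = 1
  linearIndependent : ∀ c : Fin (N + 1) → ℝ,
    (∀ᵐ v ∂(volume.restrict V), ∑ i, c i * m i v = 0) → c = 0

section Defs

variable {d N : ℕ} (η : ℝ → ℝ) (V : Set (EuclideanSpace ℝ (Fin d)))
  (m : Fin (N + 1) → EuclideanSpace ℝ (Fin d) → ℝ)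

/-- The ansatz `G_α(v) = η_*'(α · m(v))`. -/
def ansatz (α : EuclideanSpace ℝ (Fin (N + 1))) (v : EuclideanSpace ℝ (Fin d)) : ℝ :=
  deriv (legendreDual η) (∑ i, α i * m i v)

/-- The moment vector `û(α) = ⟨m G_α⟩`. -/
def momentMap (α : EuclideanSpace ℝ (Fin (N + 1))) : EuclideanSpace ℝ (Fin (N + 1)) :=
  WithLp.toLp 2 fun i => ∫ v in V, m i v * ansatz η m α v

/-- The set `𝓡^M = {û(α) : ‖α‖ ≤ M}`. -/
def momentBall (M : ℝ) : Set (EuclideanSpace ℝ (Fin (N + 1))) :=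
  momentMap η V m '' {α | ‖α‖ ≤ M}

/-- The dual objective `α ↦ α · u - ⟨η_*(α · m)⟩ - (γ / 2) ‖α‖²`; the value `γ = 0` gives the
objective of the original, unregularized problem. -/
def dualObjective (γ : ℝ) (u α : EuclideanSpace ℝ (Fin (N + 1))) : ℝ :=
  (∑ i, α i * u i) - (∫ v in V, legendreDual η (∑ i, α i * m i v)) - γ / 2 * ‖α‖ ^ 2

/-- `α` maximizes the dual objective. -/
def IsMultiplier (γ : ℝ) (u α : EuclideanSpace ℝ (Fin (N + 1))) : Prop :=
  IsMaxOn (dualObjective η V m γ u) univ α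

/-- The multiplier vector `α̂_γ(u)`, the maximizer of the dual objective; `γ = 0` gives the
original multiplier `α̂(u)`. -/
def multiplier (γ : ℝ) (u : EuclideanSpace ℝ (Fin (N + 1))) : EuclideanSpace ℝ (Fin (N + 1)) :=
  Classical.epsilon (IsMultiplier η V m γ u)

/-- The flux `f_γ(u) = ⟨v m G_{α̂_γ(u)}⟩`, with entries `⟨v_k m_i G⟩`, normed by the Euclidean
(Frobenius) norm; `γ = 0` gives the original flux `f(u)`. -/
def flux (γ : ℝ) (u : EuclideanSpace ℝ (Fin (N + 1))) :
    EuclideanSpace ℝ (Fin d × Fin (N + 1)) :=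
  WithLp.toLp 2 fun p => ∫ v in V, v p.1 * m p.2 v * ansatz η m (multiplier η V m γ u) v

/-- The regularized entropy
`h_γ(u) = ⟨η(G_{α̂_γ(u)})⟩ + ‖⟨m G_{α̂_γ(u)}⟩ - u‖² / (2 γ)`. -/
def entropy (γ : ℝ) (u : EuclideanSpace ℝ (Fin (N + 1))) : ℝ :=
  (∫ v in V, η (ansatz η m (multiplier η V m γ u) v)) +
    1 / (2 * γ) * ‖momentMap η V m (multiplier η V m γ u) - u‖ ^ 2

/-- The relative entropy `h_γ(w | u) = h_γ(w) - h_γ(u) - α̂_γ(u) · (w - u)`. -/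
def relEntropy (γ : ℝ) (w u : EuclideanSpace ℝ (Fin (N + 1))) : ℝ :=
  entropy η V m γ w - entropy η V m γ u - ∑ i, multiplier η V m γ u i * (w i - u i)

/-- The relative flux `f_γ(w | u) = f_γ(w) - f_γ(u) - f_γ'(u) (w - u)`. -/
def relFlux (γ : ℝ) (w u : EuclideanSpace ℝ (Fin (N + 1))) :
    EuclideanSpace ℝ (Fin d × Fin (N + 1)) :=
  flux η V m γ w - flux η V m γ u - fderiv ℝ (flux η V m γ) u (w - u)

/-- The Hessian `h_γ''(u)`, as the derivative of the gradient of `h_γ`. -/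
def hessEntropy (γ : ℝ) (u : EuclideanSpace ℝ (Fin (N + 1))) :
    EuclideanSpace ℝ (Fin (N + 1)) →L[ℝ] EuclideanSpace ℝ (Fin (N + 1)) :=
  fderiv ℝ (gradient (entropy η V m γ)) u

/-- `J_γ(w, u) = (w - u) h_γ''(u) (f'(u) - f_γ'(u))`, with entries
`J_{k j} = ∑_i (h_γ''(u) (w - u))_i ∂_{u_j} (f - f_γ)_{k i}(u)`. -/
def fluxDefect (γ : ℝ) (w u : EuclideanSpace ℝ (Fin (N + 1))) :
    EuclideanSpace ℝ (Fin d × Fin (N + 1)) :=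
  WithLp.toLp 2 fun p => ∑ i : Fin (N + 1), hessEntropy η V m γ u (w - u) i *
    ((fderiv ℝ (flux η V m 0) u - fderiv ℝ (flux η V m γ) u)
      (EuclideanSpace.single p.2 (1 : ℝ))) (p.1, i)

end Defs

end EntropyMoments

end

/-! Write `Ψ α = ⟨η_*(α · m)⟩` and `U = ∇Ψ = momentMap`. The maximizer is characterized by `U α + γ
α = u`, so states are best parametrized by multipliers: `u = U α + γ α`, `u_γ = U β + γ β`. Then
`h_γ(u_γ|u)` is exactly `B = bregman Ψ U α β + γ/2 ‖β - α‖²` (`relEntropy_eq`). The gradient of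
`h_γ` is the multiplier (envelope theorem), so `h_γ''(u) = P := (U'(α) + γ)⁻¹` and `f_γ'(u) = F'(α)
P`, with `F = multiplierFlux`.

If `u = U α₀` with `‖α₀‖ ≤ M`, monotonicity of `U` gives `‖α‖ ≤ M` for every `γ`, so convexity and
Taylor constants on the ball of radius `M + 1` are uniform in `γ`. For `‖β - α‖ ≤ 1` (`near`) the
relative flux is quadratic in `β - α`, and so is the lower bound for the Bregman distance. For `‖β -
α‖ ≥ 1` (`far`) `B` is bounded below, and the only danger is the size of `U β` and `F β`. Since the
ansatz is positive and `m₀ = 1`, both are controlled by the mass `⟨G_β⟩`, which `inner_le` bounds by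
the Bregman distance plus a constant.

For the flux defect, `f'(u) - f_γ'(u) = O(γ)` by a resolvent identity (`norm_sub_resolvent_le`), and
`γ ‖P (u_γ - u)‖ ≤ C (B + γ²)` (`exists_bound`). -/

namespace EntropyMoments

/-! ### Legendre duality for the entropy -/

section Legendre

variable {η : ℝ → ℝ}

theorem IsSuperlinearEntropy.contDiffOn_deriv (hη : IsSuperlinearEntropy η) :
    ContDiffOn ℝ 2 (deriv η) (Ioi 0) :=
  hη.contDiffOn.deriv_of_isOpen isOpen_Ioi (by norm_num)

theorem IsSuperlinearEntropy.strictMonoOn_deriv (hη : IsSuperlinearEntropy η) :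
    StrictMonoOn (deriv η) (Ioi 0) :=
  strictMonoOn_of_deriv_pos (convex_Ioi 0) hη.contDiffOn_deriv.continuousOn
    fun z hz => hη.deriv_deriv_pos z (by simpa using hz)

theorem IsSuperlinearEntropy.hasDerivAt (hη : IsSuperlinearEntropy η) {z : ℝ} (hz : 0 < z) :
    HasDerivAt η (deriv η z) z :=
  ((hη.contDiffOn.differentiableOn (by norm_num)).differentiableAt
    (isOpen_Ioi.mem_nhds hz)).hasDerivAt

/-- The supremum defining `η_*(y)` is attained where `η' = y`. -/
theorem IsSuperlinearEntropy.legendreDual_deriv (hη : IsSuperlinearEntropy η) {z : ℝ}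
    (hz : 0 < z) : legendreDual η (deriv η z) = deriv η z * z - η z := by
  have hconv : ConvexOn ℝ (Ioi 0) η :=
    (strictConvexOn_of_deriv2_pos (convex_Ioi 0) hη.contDiffOn.continuousOn
      fun z hz => hη.deriv_deriv_pos z (by simpa using hz)).convexOn
  refine IsGreatest.csSup_eq ⟨⟨z, hz, rfl⟩, ?_⟩
  rintro _ ⟨x, hx, rfl⟩
  rcases lt_trichotomy x z with h | rfl | h
  · have := hconv.slope_le_of_hasDerivAt hx hz h (hη.hasDerivAt hz)
    rw [slope_def_field, div_le_iff₀ (sub_pos.2 h)] at this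
    dsimp only
    linarith
  · exact le_rfl
  · have := hconv.le_slope_of_hasDerivAt hz hx h (hη.hasDerivAt hz)
    rw [slope_def_field, le_div_iff₀ (sub_pos.2 h)] at this
    dsimp only
    linarith

/-- The function `g` will turn out to be `η_*'`. Surjectivity of `η'` provides it, and strict
monotonicity makes it a genuine local inverse. -/
theorem IsSuperlinearEntropy.exists_rightInverse (hη : IsSuperlinearEntropy η) :
    ∃ g : ℝ → ℝ, (∀ y, 0 < g y) ∧ (∀ y, deriv η (g y) = y) ∧
      (∀ y, HasDerivAt g (deriv (deriv η) (g y))⁻¹ y) ∧ ContDiff ℝ 2 g := by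
  have h : ∀ y, ∃ z, 0 < z ∧ deriv η z = y := fun y => by
    have : y ∈ deriv η '' Ioi 0 := hη.range_deriv ▸ mem_univ y
    exact this
  choose g hpos hg using h
  have hd : ∀ y, HasDerivAt g (deriv (deriv η) (g y))⁻¹ y := fun y => by
    have hs : HasStrictDerivAt (deriv η) (deriv (deriv η) (g y)) (g y) :=
      (hη.contDiffOn_deriv.contDiffAt (isOpen_Ioi.mem_nhds (hpos y))).hasStrictDerivAt
        (by norm_num)
    have := hs.to_local_left_inverse (hη.deriv_deriv_pos _ (hpos y)).ne' (g := g) ?_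
    · rw [hg] at this
      exact this.hasDerivAt
    · filter_upwards [isOpen_Ioi.mem_nhds (hpos y)] with x hx
      exact hη.strictMonoOn_deriv.injOn (hpos _) hx (hg _)
  have hdiff : Differentiable ℝ g := fun y => (hd y).differentiableAt
  have hderiv : deriv g = fun y => (deriv (deriv η) (g y))⁻¹ := funext fun y => (hd y).deriv
  have hη2 : ContDiffOn ℝ 1 (deriv (deriv η)) (Ioi 0) :=
    hη.contDiffOn_deriv.deriv_of_isOpen isOpen_Ioi (by norm_num)
  -- Bootstrap through `g' = 1 / η''(g)`; it stops at `C²` because `η''` is only `C¹`.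
  have step : ∀ n : ℕ, n ≤ 1 → ContDiff ℝ n g → ContDiff ℝ (n + 1) g := fun n hn hgn => by
    refine contDiff_succ_iff_deriv.2 ⟨hdiff, by simp, ?_⟩
    rw [hderiv]
    refine ContDiff.inv ?_ fun y => (hη.deriv_deriv_pos _ (hpos y)).ne'
    exact (hη2.of_le (by exact_mod_cast hn)).comp_contDiff hgn hpos
  have h1 : ContDiff ℝ 1 g := by
    simpa using step 0 (by norm_num) (contDiff_zero.2 hdiff.continuous)
  refine ⟨g, hpos, hg, hd, ?_⟩
  have := step 1 le_rfl (by simpa using h1)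
  norm_num at this
  exact this

/-- The derivative `η_*'` is the inverse function of `η'`. -/
theorem IsSuperlinearEntropy.legendreDual_spec (hη : IsSuperlinearEntropy η) :
    Differentiable ℝ (legendreDual η) ∧ ContDiff ℝ 2 (deriv (legendreDual η)) ∧
      (∀ y, 0 < deriv (legendreDual η) y) ∧ (∀ y, 0 < deriv (deriv (legendreDual η)) y) ∧
      ∀ y, η (deriv (legendreDual η) y) = y * deriv (legendreDual η) y - legendreDual η y := by
  obtain ⟨g, hpos, hg, hd, hg2⟩ := hη.exists_rightInverse
  have hval : ∀ y, legendreDual η y = y * g y - η (g y) := fun y => by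
    have := hη.legendreDual_deriv (hpos y)
    rwa [hg] at this
  have hD : ∀ y, HasDerivAt (legendreDual η) (g y) y := fun y => by
    have h1 : HasDerivAt (fun y => η (g y)) (y * (deriv (deriv η) (g y))⁻¹) y := by
      have := (hη.hasDerivAt (hpos y)).comp y (hd y)
      rwa [hg] at this
    rw [funext hval]
    -- The two terms containing `g'` cancel because `η'(g y) = y`.
    refine (((hasDerivAt_id' y).mul (hd y)).sub h1).congr_deriv ?_
    ring
  have hderiv : deriv (legendreDual η) = g := funext fun y => (hD y).deriv
  rw [hderiv]
  refine ⟨fun y => (hD y).differentiableAt, hg2, hpos, fun y => ?_, fun y => ?_⟩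
  · rw [(hd y).deriv]
    exact inv_pos.2 (hη.deriv_deriv_pos _ (hpos y))
  · rw [hval]; ring

end Legendre

/-! ### Smoothness of integrals depending on the multiplier -/

section ParametricIntegral

variable {X E : Type} [MeasurableSpace X] {μ : Measure X}
  [NormedAddCommGroup E] [InnerProductSpace ℝ E] {c : X → E} {K : ℝ}

theorem exists_abs_le_of_continuous {k : ℝ → ℝ} (hk : Continuous k) (r : ℝ) :
    ∃ C, ∀ t, |t| ≤ r → |k t| ≤ C := by
  obtain ⟨C, hC⟩ := (isCompact_Icc (a := -r) (b := r)).exists_bound_of_continuousOn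
    hk.continuousOn
  exact ⟨C, fun t ht => hC t (abs_le.1 ht)⟩

theorem abs_inner_le_of_norm_le {x y : E} {K r : ℝ} (hx : ‖x‖ ≤ K) (hy : ‖y‖ ≤ r) :
    |inner ℝ x y| ≤ K * r :=
  (abs_real_inner_le_norm x y).trans
    (mul_le_mul hx hy (norm_nonneg _) ((norm_nonneg _).trans hx))

variable {W : Type} [NormedAddCommGroup W] [NormedSpace ℝ W] {a : X → W} {L : ℝ}

theorem aestronglyMeasurable_inner_smul (hc : AEStronglyMeasurable c μ)
    (ha : AEStronglyMeasurable a μ) {k : ℝ → ℝ} (hk : Continuous k) (α : E) :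
    AEStronglyMeasurable (fun v => k (inner ℝ (c v) α) • a v) μ :=
  (hk.comp_aestronglyMeasurable (hc.inner aestronglyMeasurable_const)).smul ha

theorem integrable_inner_smul [IsFiniteMeasure μ] (hc : AEStronglyMeasurable c μ)
    (hcK : ∀ᵐ v ∂μ, ‖c v‖ ≤ K)
    (ha : AEStronglyMeasurable a μ) (haL : ∀ᵐ v ∂μ, ‖a v‖ ≤ L) {k : ℝ → ℝ} (hk : Continuous k)
    (α : E) : Integrable (fun v => k (inner ℝ (c v) α) • a v) μ := by
  obtain ⟨C, hC⟩ := exists_abs_le_of_continuous hk (K * ‖α‖)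
  refine Integrable.of_bound (aestronglyMeasurable_inner_smul hc ha hk α) (C * L) ?_
  filter_upwards [hcK, haL] with v h1 h2
  have h3 := hC _ (abs_inner_le_of_norm_le h1 (le_refl ‖α‖))
  rw [norm_smul, Real.norm_eq_abs]
  exact mul_le_mul h3 h2 (norm_nonneg _) ((abs_nonneg _).trans h3)

/-- The derivative of the integrand of a parametric integral `∫ k ⟪c, α⟫ • a`. -/
noncomputable def weightDeriv (c : X → E) (a : X → W) (v : X) : E →L[ℝ] W :=
  (innerSL ℝ (c v)).smulRight (a v)

theorem norm_weightDeriv_le (hcK : ∀ᵐ v ∂μ, ‖c v‖ ≤ K) (haL : ∀ᵐ v ∂μ, ‖a v‖ ≤ L) :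
    ∀ᵐ v ∂μ, ‖weightDeriv c a v‖ ≤ K * L := by
  filter_upwards [hcK, haL] with v h1 h2
  rw [weightDeriv, ContinuousLinearMap.norm_smulRight_apply, innerSL_apply_norm]
  exact mul_le_mul h1 h2 (norm_nonneg _) ((norm_nonneg _).trans h1)

theorem aestronglyMeasurable_weightDeriv (hc : AEStronglyMeasurable c μ)
    (ha : AEStronglyMeasurable a μ) : AEStronglyMeasurable (weightDeriv c a) μ := by
  have h : Continuous fun p : E × W => (innerSL ℝ p.1).smulRight p.2 := by fun_prop
  exact h.comp_aestronglyMeasurable (hc.prodMk ha)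

theorem hasFDerivAt_integral_inner_smul [IsFiniteMeasure μ] (hc : AEStronglyMeasurable c μ)
    (hcK : ∀ᵐ v ∂μ, ‖c v‖ ≤ K) (ha : AEStronglyMeasurable a μ) (haL : ∀ᵐ v ∂μ, ‖a v‖ ≤ L)
    {k : ℝ → ℝ} (hk : ContDiff ℝ 1 k) (α : E) :
    HasFDerivAt (fun α => ∫ v, k (inner ℝ (c v) α) • a v ∂μ)
      (∫ v, deriv k (inner ℝ (c v) α) • weightDeriv c a v ∂μ) α := by
  have hk' : Continuous (deriv k) := hk.continuous_deriv le_rfl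
  have hD := aestronglyMeasurable_weightDeriv hc ha
  have hDb := norm_weightDeriv_le hcK haL
  -- For `β` in the unit ball around `α`, the argument `⟪c v, β⟫` stays in this compact interval,
  -- which gives a constant dominating function.
  obtain ⟨C, hC⟩ := exists_abs_le_of_continuous hk' (K * (‖α‖ + 1))
  refine hasFDerivAt_integral_of_dominated_of_fderiv_le (bound := fun _ => C * (K * L))
    (F' := fun β v => deriv k (inner ℝ (c v) β) • weightDeriv c a v)
    (Metric.ball_mem_nhds α one_pos)
    (Filter.Eventually.of_forall fun β =>
      aestronglyMeasurable_inner_smul hc ha hk.continuous β)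
    (integrable_inner_smul hc hcK ha haL hk.continuous α)
    (aestronglyMeasurable_inner_smul hc hD hk' α) ?_ (integrable_const _) ?_
  · filter_upwards [hcK, hDb] with v h1 h2 β hβ
    have hβ' : ‖β‖ ≤ ‖α‖ + 1 := by
      have := norm_le_norm_add_norm_sub' β α
      rw [Metric.mem_ball, dist_eq_norm] at hβ
      linarith
    have h3 := hC _ (abs_inner_le_of_norm_le h1 hβ')
    rw [norm_smul, Real.norm_eq_abs]
    exact mul_le_mul h3 h2 (norm_nonneg _) ((abs_nonneg _).trans h3)
  · refine Filter.Eventually.of_forall fun v β _ => ?_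
    have h1 : HasDerivAt k (deriv k (inner ℝ (c v) β)) (inner ℝ (c v) β) :=
      (hk.differentiable (by norm_num) _).hasDerivAt
    have h2 : HasFDerivAt (fun β => inner ℝ (c v) β) (innerSL ℝ (c v)) β :=
      (innerSL ℝ (c v)).hasFDerivAt
    refine ((h1.comp_hasFDerivAt β h2).smul_const (a v)).congr_fderiv ?_
    ext x
    simp [weightDeriv, mul_smul]

/-- The derivative is an integral of the same shape, with `k'` for `k` and a weight valued in `E
→L[ℝ] W`; the induction therefore quantifies over the target space and the weight. -/
theorem contDiff_integral_inner_smul [IsFiniteMeasure μ] (hc : AEStronglyMeasurable c μ)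
    (hcK : ∀ᵐ v ∂μ, ‖c v‖ ≤ K) (n : ℕ) : ∀ {W : Type} [NormedAddCommGroup W] [NormedSpace ℝ W]
    {a : X → W} {L : ℝ} (_ : AEStronglyMeasurable a μ) (_ : ∀ᵐ v ∂μ, ‖a v‖ ≤ L)
    {k : ℝ → ℝ} (_ : ContDiff ℝ n k),
    ContDiff ℝ n (fun α => ∫ v, k (inner ℝ (c v) α) • a v ∂μ) := by
  induction n with
  | zero =>
    intro W _ _ a L ha haL k hk
    have hk : Continuous k := hk.continuous
    refine contDiff_zero.2 (continuous_iff_continuousAt.2 fun α => ?_)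
    obtain ⟨C, hC⟩ := exists_abs_le_of_continuous hk (K * (‖α‖ + 1))
    refine continuousAt_of_dominated (bound := fun _ => C * L)
      (Filter.Eventually.of_forall fun β => aestronglyMeasurable_inner_smul hc ha hk β) ?_
      (integrable_const _) (Filter.Eventually.of_forall fun v => by fun_prop)
    filter_upwards [Metric.ball_mem_nhds α one_pos] with β hβ
    filter_upwards [hcK, haL] with v h1 h2
    have hβ' : ‖β‖ ≤ ‖α‖ + 1 := by
      have := norm_le_norm_add_norm_sub' β α
      rw [Metric.mem_ball, dist_eq_norm] at hβ
      linarith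
    have h3 := hC _ (abs_inner_le_of_norm_le h1 hβ')
    rw [norm_smul, Real.norm_eq_abs]
    exact mul_le_mul h3 h2 (norm_nonneg _) ((abs_nonneg _).trans h3)
  | succ n ih =>
    intro W _ _ a L ha haL k hk
    rw [Nat.cast_succ] at hk ⊢
    exact contDiff_succ_iff_hasFDerivAt.2 ⟨_,
      ih (aestronglyMeasurable_weightDeriv hc ha) (norm_weightDeriv_le hcK haL)
        (contDiff_succ_iff_deriv.1 hk).2.2,
      hasFDerivAt_integral_inner_smul hc hcK ha haL (hk.of_le (by norm_num))⟩

end ParametricIntegral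

/-! ### Convex potentials, Bregman distances and the regularized dual problem -/

section Potential

variable {E W : Type*} [NormedAddCommGroup E] [InnerProductSpace ℝ E]
  [NormedAddCommGroup W] [NormedSpace ℝ W]

/-- `U` is the gradient of the `C³` function `Ψ`, whose Hessian is positive definite. -/
structure IsConvexPotential (Ψ : E → ℝ) (U : E → E) : Prop where
  hasFDerivAt : ∀ α, HasFDerivAt Ψ (innerSL ℝ (U α)) α
  contDiff : ContDiff ℝ 2 U
  pos : ∀ α δ, δ ≠ 0 → 0 < inner ℝ (fderiv ℝ U α δ) δ

/-- The Bregman distance of `Ψ`, with gradient `U`. -/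
def bregman (Ψ : E → ℝ) (U : E → E) (α β : E) : ℝ :=
  Ψ α - Ψ β - inner ℝ (U β) (α - β)

variable {Ψ : E → ℝ} {U : E → E}

namespace IsConvexPotential

theorem differentiable (h : IsConvexPotential Ψ U) : Differentiable ℝ U :=
  h.contDiff.differentiable (by norm_num)

theorem continuous_fderiv (h : IsConvexPotential Ψ U) : Continuous (fderiv ℝ U) :=
  h.contDiff.continuous_fderiv (by norm_num)

theorem nonneg (h : IsConvexPotential Ψ U) (α δ : E) : 0 ≤ inner ℝ (fderiv ℝ U α δ) δ := by
  rcases eq_or_ne δ 0 with rfl | hδ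
  · simp
  · exact (h.pos α δ hδ).le

/-- Along the segment, `b t = bregman Ψ U α (α + t • δ)` has derivative `t ⟪U'(α + t • δ) δ, δ⟫ ≥
0`. Hence curvature near `α` alone, on `[0, T]`, already bounds the distance to the far endpoint
from below. -/
theorem le_bregman_add (h : IsConvexPotential Ψ U) {α δ : E} {T l : ℝ} (hT0 : 0 ≤ T)
    (hT1 : T ≤ 1) (hl : ∀ t ∈ Icc 0 T, l ≤ inner ℝ (fderiv ℝ U (α + t • δ) δ) δ) :
    l / 2 * T ^ 2 ≤ bregman Ψ U α (α + δ) := by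
  set b : ℝ → ℝ := fun t => Ψ α - Ψ (α + t • δ) + t * inner ℝ (U (α + t • δ)) δ with hb
  have hline : ∀ t : ℝ, HasDerivAt (fun t : ℝ => α + t • δ) δ t := fun t => by
    simpa using ((hasDerivAt_id t).smul_const δ).const_add α
  have hd : ∀ t, HasDerivAt b (t * inner ℝ (fderiv ℝ U (α + t • δ) δ) δ) t := fun t => by
    have h1 := (h.hasFDerivAt (α + t • δ)).comp_hasDerivAt t (hline t)
    have h2 := ((h.differentiable (α + t • δ)).hasFDerivAt.comp_hasDerivAt t (hline t)).inner ℝ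
      (hasDerivAt_const t δ)
    refine ((h1.const_sub (Ψ α)).add ((hasDerivAt_id' t).mul h2)).congr_deriv ?_
    simp [innerSL_apply_apply]
  have hbdiff : Differentiable ℝ b := fun t => (hd t).differentiableAt
  have hb0 : b 0 = 0 := by simp [hb]
  have hb1 : b 1 = bregman Ψ U α (α + δ) := by simp [hb, bregman]
  have hmono1 : b T ≤ b 1 := by
    refine monotoneOn_of_deriv_nonneg (convex_Icc T 1) hbdiff.continuous.continuousOn
      hbdiff.differentiableOn (fun t ht => ?_) ⟨le_rfl, hT1⟩ ⟨hT1, le_rfl⟩ hT1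
    rw [interior_Icc] at ht
    rw [(hd t).deriv]
    exact mul_nonneg (hT0.trans ht.1.le) (h.nonneg _ _)
  have hq : ∀ t, HasDerivAt (fun t => b t - l / 2 * t ^ 2)
      (t * inner ℝ (fderiv ℝ U (α + t • δ) δ) δ - l * t) t := fun t => by
    refine ((hd t).sub ((hasDerivAt_pow 2 t).const_mul (l / 2))).congr_deriv ?_
    norm_num
    ring
  have hqdiff : Differentiable ℝ fun t => b t - l / 2 * t ^ 2 :=
    fun t => (hq t).differentiableAt
  have hmono2 : b 0 - l / 2 * 0 ^ 2 ≤ b T - l / 2 * T ^ 2 := by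
    refine monotoneOn_of_deriv_nonneg (convex_Icc 0 T) hqdiff.continuous.continuousOn
      hqdiff.differentiableOn (fun t ht => ?_) ⟨le_rfl, hT0⟩ ⟨hT0, le_rfl⟩ hT0
    rw [interior_Icc] at ht
    rw [(hq t).deriv]
    nlinarith [mul_le_mul_of_nonneg_left (hl t ⟨ht.1.le, ht.2.le⟩) ht.1.le]
  rw [hb0] at hmono2
  linarith

theorem bregman_nonneg (h : IsConvexPotential Ψ U) (α β : E) : 0 ≤ bregman Ψ U α β := by
  have := h.le_bregman_add (α := α) (δ := β - α) (l := 0) le_rfl zero_le_one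
    fun t _ => h.nonneg _ _
  simpa using this

theorem inner_sub_nonneg (h : IsConvexPotential Ψ U) (α β : E) :
    0 ≤ inner ℝ (U α - U β) (α - β) := by
  have h1 := h.bregman_nonneg α β
  have h2 := h.bregman_nonneg β α
  rw [bregman] at h1 h2
  rw [← neg_sub α β, inner_neg_right] at h2
  rw [inner_sub_left]
  linarith

variable [FiniteDimensional ℝ E]

/-- Compactness of ball times unit sphere, then homogeneity in `δ`. -/
theorem exists_coercive (h : IsConvexPotential Ψ U) (R : ℝ) :
    ∃ l > 0, ∀ α, ‖α‖ ≤ R → ∀ δ, l * ‖δ‖ ^ 2 ≤ inner ℝ (fderiv ℝ U α δ) δ := by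
  have hK : IsCompact (Metric.closedBall (0 : E) R ×ˢ Metric.sphere (0 : E) 1) :=
    (isCompact_closedBall 0 R).prod (isCompact_sphere 0 1)
  have hcont : Continuous fun p : E × E => (inner ℝ (fderiv ℝ U p.1 p.2) p.2 : ℝ) :=
    ((h.continuous_fderiv.comp continuous_fst).clm_apply continuous_snd).inner continuous_snd
  obtain ⟨l, hl, hmin⟩ := hK.exists_forall_le' hcont.continuousOn (a := 0) fun p hp =>
    h.pos _ _ (norm_ne_zero_iff.1 (by rw [mem_sphere_zero_iff_norm.1 hp.2]; exact one_ne_zero))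
  refine ⟨l, hl, fun α hα δ => ?_⟩
  rcases eq_or_ne δ 0 with rfl | hδ
  · simp
  have hn : ‖δ‖ ≠ 0 := norm_ne_zero_iff.2 hδ
  have := hmin (α, ‖δ‖⁻¹ • δ) ⟨mem_closedBall_zero_iff.2 hα, by
    rw [mem_sphere_zero_iff_norm, norm_smul, norm_inv, norm_norm, inv_mul_cancel₀ hn]⟩
  simp only [map_smul, inner_smul_left, inner_smul_right, conj_trivial] at this
  calc l * ‖δ‖ ^ 2
      ≤ (‖δ‖⁻¹ * (‖δ‖⁻¹ * inner ℝ (fderiv ℝ U α δ) δ)) * ‖δ‖ ^ 2 := by gcongr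
    _ = inner ℝ (fderiv ℝ U α δ) δ := by field_simp

omit [FiniteDimensional ℝ E] in
-- Take `T = 1` for near points and `T = ‖β - α‖⁻¹` for far ones, so that the part of the segment
-- used never leaves the ball of radius `R + 1`.
theorem le_bregman_of_coercive (h : IsConvexPotential Ψ U) {R l : ℝ} (hl : 0 < l)
    (hc : ∀ α, ‖α‖ ≤ R + 1 → ∀ δ, l * ‖δ‖ ^ 2 ≤ inner ℝ (fderiv ℝ U α δ) δ)
    {α : E} (hα : ‖α‖ ≤ R) (β : E) :
    (‖β - α‖ ≤ 1 → l / 2 * ‖β - α‖ ^ 2 ≤ bregman Ψ U α β) ∧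
      (1 ≤ ‖β - α‖ → l / 2 ≤ bregman Ψ U α β) := by
  have key : ∀ T : ℝ, 0 ≤ T → T ≤ 1 → T * ‖β - α‖ ≤ 1 →
      l * ‖β - α‖ ^ 2 / 2 * T ^ 2 ≤ bregman Ψ U α β := fun T h0 h1 hT => by
    have := h.le_bregman_add (α := α) (δ := β - α) h0 h1 (l := l * ‖β - α‖ ^ 2)
      fun t ht => hc _ ?_ _
    · simpa using this
    · refine (norm_add_le _ _).trans (add_le_add hα ?_)
      rw [norm_smul, Real.norm_of_nonneg ht.1]
      exact (mul_le_mul_of_nonneg_right ht.2 (norm_nonneg _)).trans hT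
  refine ⟨fun h1 => ?_, fun h1 => ?_⟩
  · have := key 1 zero_le_one le_rfl (by simpa using h1)
    linarith
  · have h0 : 0 < ‖β - α‖ := one_pos.trans_le h1
    have := key ‖β - α‖⁻¹ (by positivity) (inv_le_one_of_one_le₀ h1) (inv_mul_cancel₀ h0.ne').le
    refine le_trans (le_of_eq ?_) this
    field_simp

theorem bregman_pos (h : IsConvexPotential Ψ U) {α β : E} (hne : β ≠ α) :
    0 < bregman Ψ U α β := by
  obtain ⟨l, hl, hc⟩ := h.exists_coercive (‖α‖ + 1)
  obtain ⟨h1, h2⟩ := h.le_bregman_of_coercive hl hc le_rfl β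
  have : 0 < ‖β - α‖ := norm_pos_iff.2 (sub_ne_zero.2 hne)
  rcases le_total ‖β - α‖ 1 with h3 | h3
  · exact lt_of_lt_of_le (by positivity) (h1 h3)
  · exact lt_of_lt_of_le (by positivity) (h2 h3)

end IsConvexPotential

/-- The objective `α ↦ ⟪α, u⟫ - Ψ α - γ / 2 ‖α‖²`. -/
noncomputable def potentialObjective (Ψ : E → ℝ) (γ : ℝ) (u α : E) : ℝ :=
  inner ℝ α u - Ψ α - γ / 2 * ‖α‖ ^ 2

/-- An exact algebraic identity at a stationary point. It yields maximality, uniqueness and the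
formula for the relative entropy. -/
theorem potentialObjective_sub {γ : ℝ} {u α : E} (hα : U α + γ • α = u) (β : E) :
    potentialObjective Ψ γ u α - potentialObjective Ψ γ u β =
      bregman Ψ U β α + γ / 2 * ‖β - α‖ ^ 2 := by
  subst hα
  simp only [potentialObjective, bregman, norm_sub_sq_real, inner_add_right, inner_smul_right,
    inner_sub_right, real_inner_self_eq_norm_sq, real_inner_comm α (U α), real_inner_comm β (U α)]
  ring

namespace IsConvexPotential

theorem hasFDerivAt_potentialObjective (h : IsConvexPotential Ψ U) (γ : ℝ) (u α : E) :
    HasFDerivAt (potentialObjective Ψ γ u) (innerSL ℝ (u - (U α + γ • α))) α := by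
  have h1 : HasFDerivAt (fun α : E => (inner ℝ u α : ℝ)) (innerSL ℝ u) α :=
    (innerSL ℝ u).hasFDerivAt
  have h2 : HasFDerivAt (fun α : E => ‖α‖ ^ 2) (2 • innerSL ℝ α) α :=
    (hasStrictFDerivAt_norm_sq α).hasFDerivAt
  have h3 := (h1.sub (h.hasFDerivAt α)).sub (h2.const_mul (γ / 2))
  have h4 : potentialObjective Ψ γ u = fun α => inner ℝ u α - Ψ α - γ / 2 * ‖α‖ ^ 2 := by
    funext β
    rw [potentialObjective, real_inner_comm]
  rw [h4]
  refine h3.congr_fderiv ?_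
  ext δ
  simp [innerSL_apply_apply]
  ring

variable [FiniteDimensional ℝ E]

theorem exists_isMaxOn_potentialObjective (h : IsConvexPotential Ψ U) {γ : ℝ} (hγ : 0 < γ)
    (u : E) : ∃ α, IsMaxOn (potentialObjective Ψ γ u) univ α := by
  have hub : ∀ α, potentialObjective Ψ γ u α ≤
      potentialObjective Ψ γ u 0 + ‖u - U 0‖ * ‖α‖ - γ / 2 * ‖α‖ ^ 2 := fun α => by
    have h1 := h.bregman_nonneg α 0
    have h2 := real_inner_le_norm (u - U 0) α
    rw [bregman, sub_zero] at h1
    rw [inner_sub_left] at h2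
    simp only [potentialObjective, inner_zero_left, norm_zero, real_inner_comm u α]
    norm_num
    linarith
  have hcont : Continuous (potentialObjective Ψ γ u) :=
    continuous_iff_continuousAt.2 fun α => (h.hasFDerivAt_potentialObjective γ u α).continuousAt
  -- Beyond this radius the quadratic penalty in `hub` outweighs the linear term, so the objective
  -- is below its value at `0`.
  set R := 2 * ‖u - U 0‖ / γ with hR
  have hR0 : 0 ≤ R := by positivity
  obtain ⟨α, -, hα⟩ := (isCompact_closedBall (0 : E) R).exists_isMaxOn
    ⟨0, Metric.mem_closedBall_self hR0⟩ hcont.continuousOn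
  refine ⟨α, fun β _ => ?_⟩
  by_cases hβ : ‖β‖ ≤ R
  · exact hα (mem_closedBall_zero_iff.2 hβ)
  · have h0 : potentialObjective Ψ γ u 0 ≤ potentialObjective Ψ γ u α :=
      hα (Metric.mem_closedBall_self hR0)
    have h1 := hub β
    have h2 : 2 * ‖u - U 0‖ ≤ γ * ‖β‖ := by
      rw [hR, not_le, div_lt_iff₀ hγ] at hβ
      linarith
    have h3 := mul_le_mul_of_nonneg_right h2 (norm_nonneg β)
    change potentialObjective Ψ γ u β ≤ potentialObjective Ψ γ u α
    nlinarith

omit [FiniteDimensional ℝ E] in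
theorem add_smul_eq_of_isMaxOn (h : IsConvexPotential Ψ U) {γ : ℝ} {u α : E}
    (hα : IsMaxOn (potentialObjective Ψ γ u) univ α) : U α + γ • α = u := by
  have h0 := (hα.isLocalMax Filter.univ_mem).hasFDerivAt_eq_zero
    (h.hasFDerivAt_potentialObjective γ u α)
  have h1 := congrArg (fun f => f (u - (U α + γ • α))) h0
  simp only [innerSL_apply_apply, zero_apply, inner_self_eq_zero] at h1
  exact (sub_eq_zero.1 h1).symm

omit [FiniteDimensional ℝ E] in
theorem isMaxOn_of_add_smul_eq (h : IsConvexPotential Ψ U) {γ : ℝ} (hγ : 0 ≤ γ) {u α : E}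
    (hα : U α + γ • α = u) : IsMaxOn (potentialObjective Ψ γ u) univ α := fun β _ => by
  have h1 := potentialObjective_sub (Ψ := Ψ) hα β
  have h2 := h.bregman_nonneg β α
  have h3 : 0 ≤ γ / 2 * ‖β - α‖ ^ 2 := by positivity
  change potentialObjective Ψ γ u β ≤ potentialObjective Ψ γ u α
  linarith

theorem eq_of_isMaxOn (h : IsConvexPotential Ψ U) {γ : ℝ} (hγ : 0 ≤ γ) {u α β : E}
    (hα : U α + γ • α = u) (hβ : IsMaxOn (potentialObjective Ψ γ u) univ β) : β = α := by
  by_contra hne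
  have h1 := potentialObjective_sub (Ψ := Ψ) hα β
  have h2 := h.bregman_pos (Ne.symm hne)
  have h3 : 0 ≤ γ / 2 * ‖β - α‖ ^ 2 := by positivity
  have h4 : potentialObjective Ψ γ u α ≤ potentialObjective Ψ γ u β := hβ (mem_univ α)
  linarith

/-- Positive definiteness gives injectivity, which suffices in finite dimension. -/
theorem exists_fderiv_equiv (h : IsConvexPotential Ψ U) {γ : ℝ} (hγ : 0 ≤ γ) (α : E) :
    ∃ e : E ≃L[ℝ] E, HasFDerivAt (fun α => U α + γ • α) (e : E →L[ℝ] E) α ∧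
      ∀ x, e x = fderiv ℝ U α x + γ • x := by
  set f : E →ₗ[ℝ] E :=
    (fderiv ℝ U α + γ • ContinuousLinearMap.id ℝ E).toLinearMap with hf
  have hfx : ∀ x, f x = fderiv ℝ U α x + γ • x := fun x => by simp [hf]
  have hinj : Function.Injective f := by
    refine (injective_iff_map_eq_zero f).2 fun x hx => ?_
    by_contra hne
    have h1 := h.pos α x hne
    have h2 : inner ℝ (f x) x = 0 := by rw [hx, inner_zero_left]
    rw [hfx, inner_add_left, inner_smul_left, real_inner_self_eq_norm_sq, conj_trivial] at h2
    have : 0 ≤ γ * ‖x‖ ^ 2 := by positivity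
    linarith
  refine ⟨(LinearEquiv.ofInjectiveEndo f hinj).toContinuousLinearEquiv, ?_, hfx⟩
  refine ((h.differentiable α).hasFDerivAt.add ((hasFDerivAt_id α).const_smul γ)).congr_fderiv ?_
  ext x
  exact (hfx x).symm

section Inverse

variable {γ : ℝ} {A : E → E}

/-- Only a left inverse is assumed, so that `γ = 0` is covered, where `U` need not be onto. -/
theorem exists_hasFDerivAt_leftInverse (h : IsConvexPotential Ψ U) (hγ : 0 ≤ γ)
    (hA : ∀ α, A (U α + γ • α) = α) (α : E) :
    ∃ P : E →L[ℝ] E, HasFDerivAt A P (U α + γ • α) ∧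
      (∀ x, P (fderiv ℝ U α x + γ • x) = x) ∧ ∀ x, fderiv ℝ U α (P x) + γ • P x = x := by
  have : CompleteSpace E := FiniteDimensional.complete ℝ E
  obtain ⟨e, he, hex⟩ := h.exists_fderiv_equiv hγ α
  have hC : ContDiff ℝ 2 fun α => U α + γ • α := h.contDiff.add (contDiff_const.smul contDiff_id)
  have hs := hC.contDiffAt.hasStrictFDerivAt' he (by norm_num)
  refine ⟨e.symm, (hs.to_local_left_inverse (Filter.Eventually.of_forall hA)).hasFDerivAt,
    fun x => ?_, fun x => ?_⟩
  · rw [← hex]; exact e.symm_apply_apply x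
  · rw [← hex]; exact e.apply_symm_apply x

theorem contDiffAt_leftInverse (h : IsConvexPotential Ψ U) (hγ : 0 ≤ γ)
    (hA : ∀ α, A (U α + γ • α) = α) (α : E) : ContDiffAt ℝ 1 A (U α + γ • α) := by
  have : CompleteSpace E := FiniteDimensional.complete ℝ E
  obtain ⟨e, he, -⟩ := h.exists_fderiv_equiv hγ α
  have hC : ContDiff ℝ 1 fun α => U α + γ • α :=
    (h.contDiff.of_le (by norm_num)).add (contDiff_const.smul contDiff_id)
  have h1 := hC.contDiffAt.to_localInverse he one_ne_zero
  exact h1.congr_of_eventuallyEq ((hC.contDiffAt.hasStrictFDerivAt' he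
    one_ne_zero).localInverse_unique (Filter.Eventually.of_forall hA))

/-- Envelope theorem: the maximal value has the maximizer as its gradient. -/
theorem hasFDerivAt_value (h : IsConvexPotential Ψ U) (hγ : 0 ≤ γ)
    (hA : ∀ α, A (U α + γ • α) = α) (hA' : ∀ u, U (A u) + γ • A u = u) (u : E) :
    HasFDerivAt (fun u => potentialObjective Ψ γ u (A u)) (innerSL ℝ (A u)) u := by
  obtain ⟨P, hP, -⟩ := h.exists_hasFDerivAt_leftInverse hγ hA (A u)
  rw [hA'] at hP
  have h1 := hP.inner ℝ (hasFDerivAt_id u)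
  have h2 := (h.hasFDerivAt_potentialObjective γ 0 (A u)).comp u hP
  -- Isolating the explicit `u` lets the chain rule apply to each summand; the two contributions
  -- through `A'` cancel by stationarity.
  have h3 : (fun u => potentialObjective Ψ γ u (A u)) =
      fun u => inner ℝ (A u) (id u) + potentialObjective Ψ γ 0 (A u) := by
    funext u
    simp [potentialObjective]
    ring
  rw [h3]
  refine (h1.add h2).congr_fderiv ?_
  ext δ
  simp [innerSL_apply_apply, hA', fderivInnerCLM_apply, real_inner_comm]

theorem contDiff_value (h : IsConvexPotential Ψ U) (hγ : 0 ≤ γ)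
    (hA : ∀ α, A (U α + γ • α) = α) (hA' : ∀ u, U (A u) + γ • A u = u) :
    ContDiff ℝ 2 fun u => potentialObjective Ψ γ u (A u) := by
  have h1 : ContDiff ℝ 1 A := contDiff_iff_contDiffAt.2 fun u => by
    simpa [hA'] using h.contDiffAt_leftInverse hγ hA (A u)
  have := (contDiff_succ_iff_hasFDerivAt (n := 1)).2 ⟨fun u => innerSL ℝ (A u),
    (innerSL ℝ).contDiff.comp (by exact_mod_cast h1), h.hasFDerivAt_value hγ hA hA'⟩
  norm_num at this
  exact this

end Inverse

end IsConvexPotential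

end Potential

/-! ### Estimates uniform in the regularization parameter -/

section Estimates

variable {E W : Type*} [NormedAddCommGroup E] [InnerProductSpace ℝ E]
  [NormedAddCommGroup W] [NormedSpace ℝ W]

/-- Bounds on a ball for a `C²` function, its derivative and its Taylor remainder. -/
structure TaylorBound (G : E → W) (R L : ℝ) : Prop where
  nonneg : 0 ≤ L
  norm_le : ∀ α, ‖α‖ ≤ R → ‖G α‖ ≤ L
  norm_fderiv_le : ∀ α, ‖α‖ ≤ R → ‖fderiv ℝ G α‖ ≤ L
  norm_fderiv_sub_le : ∀ α β, ‖α‖ ≤ R → ‖β‖ ≤ R →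
    ‖fderiv ℝ G β - fderiv ℝ G α‖ ≤ L * ‖β - α‖
  norm_sub_le : ∀ α β, ‖α‖ ≤ R → ‖β‖ ≤ R →
    ‖G β - G α - fderiv ℝ G α (β - α)‖ ≤ L * ‖β - α‖ ^ 2

theorem TaylorBound.mono {G : E → W} {R L L' : ℝ} (h : TaylorBound G R L) (hL : L ≤ L') :
    TaylorBound G R L' where
  nonneg := h.nonneg.trans hL
  norm_le α hα := (h.norm_le α hα).trans hL
  norm_fderiv_le α hα := (h.norm_fderiv_le α hα).trans hL
  norm_fderiv_sub_le α β hα hβ := (h.norm_fderiv_sub_le α β hα hβ).trans (by gcongr)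
  norm_sub_le α β hα hβ := (h.norm_sub_le α β hα hβ).trans (by gcongr)

theorem ContDiff.exists_taylorBound [FiniteDimensional ℝ E] {G : E → W} (hG : ContDiff ℝ 2 G)
    (R : ℝ) : ∃ L, TaylorBound G R L := by
  have hG1 : ContDiff ℝ 1 (fderiv ℝ G) := hG.fderiv_right (by norm_num)
  have hG2 : Continuous (fderiv ℝ (fderiv ℝ G)) := hG1.continuous_fderiv one_ne_zero
  have hc := isCompact_closedBall (0 : E) R
  obtain ⟨L0, h0⟩ := hc.exists_bound_of_continuousOn hG.continuous.continuousOn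
  obtain ⟨L1, h1⟩ := hc.exists_bound_of_continuousOn hG1.continuous.continuousOn
  obtain ⟨L2, h2⟩ := hc.exists_bound_of_continuousOn
    (f := fderiv ℝ (fderiv ℝ G)) hG2.continuousOn
  set L := max 0 (max L0 (max L1 L2)) with hL
  have hL0 : L0 ≤ L := by simp [hL]
  have hL1 : L1 ≤ L := by simp [hL]
  have hL2 : L2 ≤ L := by simp [hL]
  have hLn : 0 ≤ L := by simp [hL]
  have hlip : ∀ α ∈ Metric.closedBall (0 : E) R, ∀ β ∈ Metric.closedBall (0 : E) R,
      ‖fderiv ℝ G β - fderiv ℝ G α‖ ≤ L * ‖β - α‖ := fun α hα β hβ =>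
    (convex_closedBall 0 R).norm_image_sub_le_of_norm_fderiv_le
      (fun x _ => hG1.differentiable one_ne_zero x) (fun x hx => (h2 x hx).trans hL2) hα hβ
  refine ⟨L, hLn, fun α hα => (h0 α (mem_closedBall_zero_iff.2 hα)).trans hL0,
    fun α hα => (h1 α (mem_closedBall_zero_iff.2 hα)).trans hL1,
    fun α β hα hβ => hlip α (mem_closedBall_zero_iff.2 hα) β (mem_closedBall_zero_iff.2 hβ),
    fun α β hα hβ => ?_⟩
  have hα' := mem_closedBall_zero_iff.2 hα
  have hsub : segment ℝ α β ⊆ Metric.closedBall 0 R :=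
    (convex_closedBall 0 R).segment_subset hα' (mem_closedBall_zero_iff.2 hβ)
  have := (convex_segment α β).norm_image_sub_le_of_norm_hasFDerivWithin_le'
    (f := G) (f' := fderiv ℝ G) (φ := fderiv ℝ G α) (C := L * ‖β - α‖)
    (fun x _ => (hG.differentiable (by norm_num) x).hasFDerivAt.hasFDerivWithinAt)
    (fun x hx => (hlip α hα' x (hsub hx)).trans ?_)
    (left_mem_segment ℝ α β) (right_mem_segment ℝ α β)
  · rwa [pow_two, ← mul_assoc]
  · gcongr
    obtain ⟨t, ht, rfl⟩ := (segment_eq_image' ℝ α β ▸ hx :)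
    rw [add_sub_cancel_left, norm_smul, Real.norm_of_nonneg ht.1]
    exact mul_le_of_le_one_left (norm_nonneg _) ht.2

/-- `P` is the inverse of `H + γ`. -/
structure IsResolvent (H : E →L[ℝ] E) (γ : ℝ) (P : E →L[ℝ] E) : Prop where
  apply_left : ∀ x, P (H x + γ • x) = x
  apply_right : ∀ x, H (P x) + γ • P x = x

/-- Pair `x = H (P x) + γ P x` with `P x`: the `γ` term has the good sign, so the bound does not
depend on `γ`. -/
theorem IsResolvent.norm_apply_le {H P : E →L[ℝ] E} {γ l : ℝ} (hP : IsResolvent H γ P)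
    (hγ : 0 ≤ γ) (hl : 0 < l) (hH : ∀ δ, l * ‖δ‖ ^ 2 ≤ inner ℝ (H δ) δ) (x : E) :
    ‖P x‖ ≤ l⁻¹ * ‖x‖ := by
  have h1 : inner ℝ x (P x) = inner ℝ (H (P x)) (P x) + γ * ‖P x‖ ^ 2 := by
    rw [← real_inner_self_eq_norm_sq, ← real_inner_smul_left, ← inner_add_left, hP.apply_right]
  have h2 := hH (P x)
  have h3 := real_inner_le_norm x (P x)
  have h4 : 0 ≤ γ * ‖P x‖ ^ 2 := by positivity
  rw [inv_mul_eq_div, le_div_iff₀ hl]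
  rcases (norm_nonneg (P x)).eq_or_lt with h5 | h5
  · rw [← h5, zero_mul]; exact norm_nonneg _
  · refine le_of_mul_le_mul_right ?_ h5
    nlinarith

variable {Ψ : E → ℝ} {U : E → E} {F : E → W}

/-- The hypotheses shared by the estimates: `R = M + 1`, coercivity and Taylor bounds on the ball
of radius `R`, and control of `U` and `F` by the pairing of `U` with `e`. -/
structure EstimateData (Ψ : E → ℝ) (U : E → E) (F : E → W) (e : E) (M l L K D : ℝ) : Prop where
  potential : IsConvexPotential Ψ U
  l_pos : 0 < l
  K_nonneg : 0 ≤ K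
  coercive : ∀ α, ‖α‖ ≤ M + 1 → ∀ δ, l * ‖δ‖ ^ 2 ≤ inner ℝ (fderiv ℝ U α δ) δ
  boundU : TaylorBound U (M + 1) L
  boundF : TaylorBound F (M + 1) L
  norm_U_le : ∀ β, ‖U β‖ ≤ K * inner ℝ (U β) e
  norm_F_le : ∀ β, ‖F β‖ ≤ K * inner ℝ (U β) e
  D_nonneg : 0 ≤ D
  shift_le : ∀ α, ‖α‖ ≤ M → Ψ (α + e) - Ψ α ≤ D

/-- Regularization shrinks the multiplier: monotonicity of `U` gives `⟪β, α - β⟫ ≥ 0`. This keeps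
`α̂_γ(u)` in the ball of radius `M` for all `γ`. -/
theorem IsConvexPotential.norm_le_of_add_smul_eq (h : IsConvexPotential Ψ U) {α β : E} {γ : ℝ}
    (hγ : 0 < γ) (hU : U β + γ • β = U α) : ‖β‖ ≤ ‖α‖ := by
  have h1 := h.inner_sub_nonneg α β
  rw [← hU, add_sub_cancel_left, real_inner_smul_left, inner_sub_right,
    real_inner_self_eq_norm_sq] at h1
  have h2 := nonneg_of_mul_nonneg_right h1 hγ
  have h3 := real_inner_le_norm β α
  nlinarith [norm_nonneg α, norm_nonneg β]

namespace EstimateData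

variable {e : E} {M l L K D : ℝ} {α β : E} {γ γ₀ : ℝ} {P : E →L[ℝ] E}

/-- This is nonnegativity of the Bregman distance from the shifted point `α + e` to `β`. It controls
the mass of the ansatz for unbounded `β`. -/
theorem inner_le (h : EstimateData Ψ U F e M l L K D) (hα : ‖α‖ ≤ M) (β : E) :
    inner ℝ (U β) e ≤ bregman Ψ U α β + D := by
  have h1 := h.potential.bregman_nonneg (α + e) β
  have h2 := h.shift_le α hα
  rw [bregman, add_sub_right_comm, inner_add_right] at h1
  rw [bregman]
  linarith

/-- As `P` inverts `U'(α) + γ`, the vector `P (u_γ - u)` differs from `β - α` only by `P` applied to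
the Taylor remainder of `U`. -/
theorem near (h : EstimateData Ψ U F e M l L K D) (hα : ‖α‖ ≤ M) (hγ : 0 ≤ γ)
    (hP : IsResolvent (fderiv ℝ U α) γ P) (hn : ‖β - α‖ ≤ 1) :
    ‖P (U β + γ • β - (U α + γ • α))‖ ≤ (1 + l⁻¹ * L) * ‖β - α‖ ∧
    ‖F β - F α - fderiv ℝ F α (P (U β + γ • β - (U α + γ • α)))‖ ≤
      (L + L * (l⁻¹ * L)) * ‖β - α‖ ^ 2 := by
  have hα1 : ‖α‖ ≤ M + 1 := by linarith
  have hβ : ‖β‖ ≤ M + 1 := by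
    have := norm_le_norm_add_norm_sub' β α
    linarith
  have hl := h.l_pos
  have hL := h.boundU.nonneg
  have h1 : P (U β + γ • β - (U α + γ • α)) - (β - α) =
      P (U β - U α - fderiv ℝ U α (β - α)) := by
    rw [sub_eq_iff_eq_add]
    nth_rw 2 [← hP.apply_left (β - α)]
    rw [← map_add]
    congr 1
    module
  have h2 : ‖P (U β + γ • β - (U α + γ • α)) - (β - α)‖ ≤ l⁻¹ * L * ‖β - α‖ ^ 2 := by
    rw [h1, mul_assoc]
    exact (hP.norm_apply_le hγ hl (h.coercive α hα1) _).trans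
      (by gcongr; exact h.boundU.norm_sub_le α β hα1 hβ)
  set y := P (U β + γ • β - (U α + γ • α))
  constructor
  · have h3 := norm_le_norm_add_norm_sub' y (β - α)
    have h4 : l⁻¹ * L * ‖β - α‖ ^ 2 ≤ l⁻¹ * L * ‖β - α‖ := by
      gcongr
      exact pow_le_of_le_one (norm_nonneg _) hn two_ne_zero
    linarith
  · have h3 : F β - F α - fderiv ℝ F α y = (F β - F α - fderiv ℝ F α (β - α)) -
        fderiv ℝ F α (y - (β - α)) := by
      rw [map_sub (fderiv ℝ F α) y]; abel
    have h4 := h.boundF.norm_sub_le α β hα1 hβ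
    have h5 : ‖fderiv ℝ F α (y - (β - α))‖ ≤ L * (l⁻¹ * L * ‖β - α‖ ^ 2) :=
      (ContinuousLinearMap.le_opNorm _ _).trans
        (mul_le_mul (h.boundF.norm_fderiv_le α hα1) h2 (norm_nonneg _) hL)
    rw [h3]
    refine (norm_sub_le _ _).trans ?_
    linarith

/-- No Taylor expansion here: each term is bounded separately, and every constant is absorbed into
`B` through `1 ≤ (2 / l) B`. -/
theorem far (h : EstimateData Ψ U F e M l L K D) (hα : ‖α‖ ≤ M) (hγ : 0 ≤ γ) (hγ₀ : γ ≤ γ₀)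
    (hP : IsResolvent (fderiv ℝ U α) γ P) {B : ℝ}
    (hB : bregman Ψ U α β + γ / 2 * ‖β - α‖ ^ 2 = B) (hlB : l / 2 ≤ B) :
    ‖P (U β + γ • β - (U α + γ • α))‖ ≤
      l⁻¹ * (K * (1 + D * (2 / l)) + (L + γ₀) * (2 / l) + 2) * B ∧
    ‖F β - F α - fderiv ℝ F α (P (U β + γ • β - (U α + γ • α)))‖ ≤
      (K * (1 + D * (2 / l)) + L * (2 / l) +
        L * (l⁻¹ * (K * (1 + D * (2 / l)) + (L + γ₀) * (2 / l) + 2))) * B := by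
  have hα1 : ‖α‖ ≤ M + 1 := by linarith
  have hl := h.l_pos
  have hL := h.boundU.nonneg
  have hK := h.K_nonneg
  have hone : 1 ≤ 2 / l * B := by
    rw [div_mul_eq_mul_div, le_div_iff₀ hl]; linarith
  have hsq : 0 ≤ γ / 2 * ‖β - α‖ ^ 2 := by positivity
  have hN : K * inner ℝ (U β) e ≤ K * (1 + D * (2 / l)) * B := by
    rw [mul_assoc]
    gcongr
    have := h.inner_le hα β
    have := mul_le_mul_of_nonneg_left hone h.D_nonneg
    linarith
  have hL' : L ≤ L * (2 / l) * B := by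
    have := mul_le_mul_of_nonneg_left hone hL
    linarith
  have hγ' : γ ≤ γ₀ * (2 / l) * B := by
    have := mul_le_mul_of_nonneg_left hone (hγ.trans hγ₀)
    linarith
  -- Use `r ≤ 1 + r²`; the square is paid for by the penalty part of `B`.
  have hγd : γ * ‖β - α‖ ≤ γ + 2 * B := by
    have h1 := h.potential.bregman_nonneg α β
    have h2 : ‖β - α‖ ≤ 1 + ‖β - α‖ ^ 2 := by nlinarith [sq_nonneg (‖β - α‖ - 1)]
    have h3 := mul_le_mul_of_nonneg_left h2 hγ
    linarith
  have hw : ‖U β + γ • β - (U α + γ • α)‖ ≤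
      (K * (1 + D * (2 / l)) + (L + γ₀) * (2 / l) + 2) * B := by
    have h1 : U β + γ • β - (U α + γ • α) = U β - U α + γ • (β - α) := by module
    have h2 := norm_add_le (U β - U α) (γ • (β - α))
    have h3 := norm_sub_le (U β) (U α)
    rw [norm_smul, Real.norm_of_nonneg hγ] at h2
    have h4 := h.norm_U_le β
    have h5 := h.boundU.norm_le α hα1
    rw [h1]
    linarith
  have hy : ‖P (U β + γ • β - (U α + γ • α))‖ ≤
      l⁻¹ * (K * (1 + D * (2 / l)) + (L + γ₀) * (2 / l) + 2) * B := by
    rw [mul_assoc]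
    exact (hP.norm_apply_le hγ hl (h.coercive α hα1) _).trans (by gcongr)
  refine ⟨hy, ?_⟩
  set y := P (U β + γ • β - (U α + γ • α))
  have h1 : ‖fderiv ℝ F α y‖ ≤ L * (l⁻¹ * (K * (1 + D * (2 / l)) + (L + γ₀) * (2 / l) + 2) * B) :=
    (ContinuousLinearMap.le_opNorm _ _).trans
      (mul_le_mul (h.boundF.norm_fderiv_le α hα1) hy (norm_nonneg _) hL)
  have h2 := norm_sub_le (F β - F α) (fderiv ℝ F α y)
  have h3 := norm_sub_le (F β) (F α)
  have h4 := h.norm_F_le β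
  have h5 := h.boundF.norm_le α hα1
  linarith

theorem exists_bound (h : EstimateData Ψ U F e M l L K D) (γ₀ : ℝ) (hγ₀ : 0 ≤ γ₀) :
    ∃ C, 0 ≤ C ∧ ∀ α β γ P, ‖α‖ ≤ M → 0 ≤ γ → γ ≤ γ₀ → IsResolvent (fderiv ℝ U α) γ P →
      ‖F β - F α - fderiv ℝ F α (P (U β + γ • β - (U α + γ • α)))‖ ≤
        C * (bregman Ψ U α β + γ / 2 * ‖β - α‖ ^ 2) ∧
      γ * ‖P (U β + γ • β - (U α + γ • α))‖ ≤
        C * (bregman Ψ U α β + γ / 2 * ‖β - α‖ ^ 2 + γ ^ 2) := by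
  have hl := h.l_pos
  have hL := h.boundU.nonneg
  have hK := h.K_nonneg
  have hD := h.D_nonneg
  set C1 := 1 + l⁻¹ * L with hC1
  set C2 := L + L * (l⁻¹ * L) with hC2
  set C3 := l⁻¹ * (K * (1 + D * (2 / l)) + (L + γ₀) * (2 / l) + 2) with hC3
  set C4 := K * (1 + D * (2 / l)) + L * (2 / l) + L * C3 with hC4
  have p1 : 0 ≤ C1 := by positivity
  have p2 : 0 ≤ C2 := by positivity
  have p3 : 0 ≤ C3 := by positivity
  have p4 : 0 ≤ C4 := by positivity
  refine ⟨C1 * (2 / l) + C1 + C2 * (2 / l) + γ₀ * C3 + C4, by positivity,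
    fun α β γ P hα hγ hγγ hP => ?_⟩
  set B := bregman Ψ U α β + γ / 2 * ‖β - α‖ ^ 2 with hB
  have hsq : 0 ≤ γ / 2 * ‖β - α‖ ^ 2 := by positivity
  obtain ⟨n, f⟩ := h.potential.le_bregman_of_coercive hl h.coercive hα β
  have hB0 : 0 ≤ B := add_nonneg (h.potential.bregman_nonneg α β) hsq
  set C := C1 * (2 / l) + C1 + C2 * (2 / l) + γ₀ * C3 + C4 with hC
  have q1 : 0 ≤ C1 * (2 / l) := by positivity
  have q2 : 0 ≤ C2 * (2 / l) := by positivity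
  have q3 : 0 ≤ γ₀ * C3 := by positivity
  have hC0 : 0 ≤ C := by positivity
  rcases le_total ‖β - α‖ 1 with h1 | h1
  · obtain ⟨e1, e2⟩ := h.near hα hγ hP h1
    have h2 : ‖β - α‖ ^ 2 ≤ 2 / l * B := by
      rw [div_mul_eq_mul_div, le_div_iff₀ hl]
      linarith [n h1]
    refine ⟨e2.trans ?_, ?_⟩
    · calc C2 * ‖β - α‖ ^ 2 ≤ C2 * (2 / l * B) := by gcongr
        _ = C2 * (2 / l) * B := by ring
        _ ≤ C * B := by gcongr; linarith
    -- Young's inequality; this is the source of the `γ²` in the defect estimate.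
    · have h3 : γ * ‖β - α‖ ≤ γ ^ 2 + 2 / l * B := by
        nlinarith [sq_nonneg (γ - ‖β - α‖), sq_nonneg γ, sq_nonneg ‖β - α‖]
      calc γ * ‖P (U β + γ • β - (U α + γ • α))‖ ≤ γ * (C1 * ‖β - α‖) := by gcongr
        _ = C1 * (γ * ‖β - α‖) := by ring
        _ ≤ C1 * (γ ^ 2 + 2 / l * B) := by gcongr
        _ = C1 * (2 / l) * B + C1 * γ ^ 2 := by ring
        _ ≤ C * B + C * γ ^ 2 := by gcongr <;> linarith
        _ = C * (B + γ ^ 2) := by ring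
  · obtain ⟨e1, e2⟩ := h.far hα hγ hγγ hP hB.symm (by linarith [f h1])
    refine ⟨e2.trans (by gcongr; linarith), ?_⟩
    calc γ * ‖P (U β + γ • β - (U α + γ • α))‖ ≤ γ₀ * (C3 * B) := by gcongr
      _ = γ₀ * C3 * B := by ring
      _ ≤ C * B := by gcongr; linarith
      _ ≤ C * (B + γ ^ 2) := by gcongr; linarith [sq_nonneg γ]

/-- Adding the two Bregman distances gives strong monotonicity, `l ‖β - α‖² ≤ ⟪U β - U α, β - α⟫ =
-γ ⟪β, β - α⟫`, and `‖β‖ ≤ M`. -/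
theorem norm_sub_le (h : EstimateData Ψ U F e M l L K D) (hα : ‖α‖ ≤ M) (hβ : ‖β‖ ≤ M)
    (hγ : 0 ≤ γ) (hU : U β + γ • β = U α) : ‖β - α‖ ≤ l⁻¹ * M * γ := by
  have hl := h.l_pos
  have key : ∀ α β : E, ‖α‖ ≤ M → ‖β‖ ≤ M → l * ‖β - α‖ ^ 2 / 2 ≤ bregman Ψ U α β :=
    fun α β hα hβ => by
      have := h.potential.le_bregman_add (α := α) (δ := β - α) zero_le_one le_rfl
        (l := l * ‖β - α‖ ^ 2) fun t ht => h.coercive _ ?_ _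
      · simpa using this
      · have := (convex_closedBall (0 : E) M).add_smul_sub_mem (mem_closedBall_zero_iff.2 hα)
          (mem_closedBall_zero_iff.2 hβ) ht
        linarith [mem_closedBall_zero_iff.1 this]
  have h1 := key α β hα hβ
  have h2 := key β α hβ hα
  rw [bregman, ← neg_sub β α, inner_neg_right] at h1
  rw [bregman, norm_sub_rev] at h2
  have h3 : inner ℝ (U α) (β - α) = inner ℝ (U β) (β - α) + γ * inner ℝ β (β - α) := by
    rw [← hU, inner_add_left, real_inner_smul_left]
  have h4 := neg_le_of_abs_le (abs_real_inner_le_norm β (β - α))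
  have h5 : ‖β‖ * ‖β - α‖ ≤ M * ‖β - α‖ := by gcongr
  have h6 := mul_le_mul_of_nonneg_left (h5.trans' (neg_le.1 h4)) hγ
  rw [inv_mul_eq_div, div_mul_eq_mul_div, le_div_iff₀ hl]
  rcases (norm_nonneg (β - α)).eq_or_lt with h7 | h7
  · rw [← h7, zero_mul]
    exact mul_nonneg ((norm_nonneg α).trans hα) hγ
  · refine le_of_mul_le_mul_right ?_ h7
    nlinarith

/-- Resolvent identity `P - Q = Q (U'(β) - U'(α) + γ) P`, where `U'` and `F'` each vary by `O(‖β -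
α‖) = O(γ)`. It compares `f'(u)` with `f_γ'(u)`. -/
theorem norm_sub_resolvent_le (h : EstimateData Ψ U F e M l L K D) (hα : ‖α‖ ≤ M)
    (hβ : ‖β‖ ≤ M) (hγ : 0 ≤ γ) (hU : U β + γ • β = U α) {Q : E →L[ℝ] E}
    (hP : IsResolvent (fderiv ℝ U α) 0 P) (hQ : IsResolvent (fderiv ℝ U β) γ Q) :
    ‖(fderiv ℝ F α).comp P - (fderiv ℝ F β).comp Q‖ ≤
      (L * (l⁻¹ * M) * l⁻¹ + L * (l⁻¹ * ((L * (l⁻¹ * M) + 1) * l⁻¹))) * γ := by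
  have hl := h.l_pos
  have hL := h.boundU.nonneg
  have hM : 0 ≤ M := (norm_nonneg α).trans hα
  have hα1 : ‖α‖ ≤ M + 1 := by linarith
  have hβ1 : ‖β‖ ≤ M + 1 := by linarith
  have hd := h.norm_sub_le hα hβ hγ hU
  refine ContinuousLinearMap.opNorm_le_bound _ (by positivity) fun x => ?_
  have hPx := hP.norm_apply_le le_rfl hl (h.coercive α hα1) x
  set y := P x with hy
  have hx : fderiv ℝ U α y = x := by simpa [hy] using hP.apply_right x
  have h1 : y - Q x = Q ((fderiv ℝ U β - fderiv ℝ U α) y + γ • y) := by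
    nth_rw 1 [← hQ.apply_left y]
    rw [← map_sub, ← hx]
    congr 1
    simp only [sub_apply]
    abel
  have h2 : ‖(fderiv ℝ U β - fderiv ℝ U α) y + γ • y‖ ≤
      ((L * (l⁻¹ * M) + 1) * γ) * (l⁻¹ * ‖x‖) := by
    refine (norm_add_le _ _).trans ?_
    have h3 : ‖(fderiv ℝ U β - fderiv ℝ U α) y‖ ≤ L * (l⁻¹ * M * γ) * (l⁻¹ * ‖x‖) :=
      (ContinuousLinearMap.le_opNorm _ _).trans (mul_le_mul
        ((h.boundU.norm_fderiv_sub_le α β hα1 hβ1).trans (by gcongr)) hPx (norm_nonneg _)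
        (by positivity))
    have h4 : ‖γ • y‖ ≤ γ * (l⁻¹ * ‖x‖) := by
      rw [norm_smul, Real.norm_of_nonneg hγ]
      gcongr
    linarith
  have h3 : ‖y - Q x‖ ≤ l⁻¹ * (((L * (l⁻¹ * M) + 1) * γ) * (l⁻¹ * ‖x‖)) := by
    rw [h1]
    exact (hQ.norm_apply_le hγ hl (h.coercive β hβ1) _).trans (by gcongr)
  have h4 : ((fderiv ℝ F α).comp P - (fderiv ℝ F β).comp Q) x =
      (fderiv ℝ F α - fderiv ℝ F β) y + fderiv ℝ F β (y - Q x) := by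
    simp only [sub_apply, ContinuousLinearMap.comp_apply, map_sub, ← hy]
    abel
  have h5 : ‖(fderiv ℝ F α - fderiv ℝ F β) y‖ ≤ L * (l⁻¹ * M * γ) * (l⁻¹ * ‖x‖) := by
    refine (ContinuousLinearMap.le_opNorm _ _).trans (mul_le_mul ?_ hPx (norm_nonneg _)
        (by positivity))
    refine (h.boundF.norm_fderiv_sub_le β α hβ1 hα1).trans ?_
    rw [norm_sub_rev]
    gcongr
  have h6 : ‖fderiv ℝ F β (y - Q x)‖ ≤
      L * (l⁻¹ * (((L * (l⁻¹ * M) + 1) * γ) * (l⁻¹ * ‖x‖))) :=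
    (ContinuousLinearMap.le_opNorm _ _).trans (mul_le_mul (h.boundF.norm_fderiv_le β hβ1) h3
      (norm_nonneg _) hL)
  rw [h4]
  refine (norm_add_le _ _).trans ((add_le_add h5 h6).trans (le_of_eq ?_))
  ring

end EstimateData

end Estimates

/-! ### The moment system as a convex potential -/

section Moments

theorem norm_le_sum_norm_apply {ι : Type} [Fintype ι] (x : EuclideanSpace ℝ ι) :
    ‖x‖ ≤ ∑ i, ‖x i‖ := by
  refine abs_le_of_sq_le_sq' ?_ (Finset.sum_nonneg fun i _ => norm_nonneg _) |>.2
  rw [EuclideanSpace.norm_sq_eq]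
  exact Finset.sum_sq_le_sq_sum_of_nonneg fun i _ => norm_nonneg _

theorem ofLp_integral {X ι : Type} [MeasurableSpace X] {μ : Measure X} [Fintype ι]
    {f : X → EuclideanSpace ℝ ι} (hf : Integrable f μ) (i : ι) :
    (∫ v, f v ∂μ) i = ∫ v, f v i ∂μ :=
  ((EuclideanSpace.proj i : EuclideanSpace ℝ ι →L[ℝ] ℝ).integral_comp_comm hf).symm

theorem aestronglyMeasurable_toLp {X ι : Type} [MeasurableSpace X] {μ : Measure X} [Fintype ι]
    {f : X → ι → ℝ} (hf : ∀ i, AEMeasurable (fun v => f v i) μ) :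
    AEStronglyMeasurable (fun v => (WithLp.toLp 2 (f v) : EuclideanSpace ℝ ι)) μ :=
  (PiLp.continuous_toLp 2 _).comp_aestronglyMeasurable
    (aemeasurable_pi_lambda _ hf).aestronglyMeasurable

variable {d N : ℕ} {η : ℝ → ℝ} {V : Set (EuclideanSpace ℝ (Fin d))}
  {m : Fin (N + 1) → EuclideanSpace ℝ (Fin d) → ℝ}

/-- The vector `m(v)` of basis functions. -/
def basisVec (m : Fin (N + 1) → EuclideanSpace ℝ (Fin d) → ℝ) (v : EuclideanSpace ℝ (Fin d)) :
    EuclideanSpace ℝ (Fin (N + 1)) :=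
  WithLp.toLp 2 fun i => m i v

/-- The matrix `v m(v)`. -/
noncomputable def fluxVec (m : Fin (N + 1) → EuclideanSpace ℝ (Fin d) → ℝ)
    (v : EuclideanSpace ℝ (Fin d)) : EuclideanSpace ℝ (Fin d × Fin (N + 1)) :=
  WithLp.toLp 2 fun p => v p.1 * m p.2 v

theorem inner_basisVec (v : EuclideanSpace ℝ (Fin d)) (α : EuclideanSpace ℝ (Fin (N + 1))) :
    inner ℝ (basisVec m v) α = ∑ i, α i * m i v := by
  simp [PiLp.inner_apply, basisVec]

namespace IsMomentBasis

theorem isFiniteMeasure (hm : IsMomentBasis V m) : IsFiniteMeasure (volume.restrict V) :=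
  ⟨by simpa using hm.isBounded.measure_lt_top⟩

theorem aestronglyMeasurable_basisVec (hm : IsMomentBasis V m) :
    AEStronglyMeasurable (basisVec m) (volume.restrict V) :=
  aestronglyMeasurable_toLp hm.aemeasurable

theorem aestronglyMeasurable_fluxVec (hm : IsMomentBasis V m) :
    AEStronglyMeasurable (fluxVec m) (volume.restrict V) :=
  aestronglyMeasurable_toLp fun p => by
    have h : Measurable fun v : EuclideanSpace ℝ (Fin d) => v p.1 := by fun_prop
    exact h.aemeasurable.mul (hm.aemeasurable p.2)

theorem norm_basisVec_le (hm : IsMomentBasis V m) :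
    ∀ᵐ v ∂(volume.restrict V), ‖basisVec m v‖ ≤ N + 1 := by
  filter_upwards [ae_all_iff.2 hm.abs_le_one] with v hv
  refine (norm_le_sum_norm_apply _).trans ((Finset.sum_le_sum fun i _ => hv i).trans ?_)
  simp

theorem exists_norm_fluxVec_le (hm : IsMomentBasis V m) :
    ∃ L, 0 ≤ L ∧ ∀ᵐ v ∂(volume.restrict V), ‖fluxVec m v‖ ≤ L := by
  obtain ⟨R, hR⟩ := hm.isBounded.exists_norm_le
  refine ⟨∑ _p : Fin d × Fin (N + 1), |R|, by positivity, ?_⟩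
  filter_upwards [ae_all_iff.2 hm.abs_le_one, ae_restrict_mem hm.measurableSet] with v hv hvV
  refine (norm_le_sum_norm_apply _).trans (Finset.sum_le_sum fun p _ => ?_)
  change ‖v p.1 * m p.2 v‖ ≤ |R|
  rw [norm_mul]
  have h1 : ‖v p.1‖ ≤ |R| := (PiLp.norm_apply_le v p.1).trans ((hR v hvV).trans (le_abs_self R))
  exact (mul_le_mul h1 (hv p.2) (abs_nonneg _) (abs_nonneg _)).trans (mul_one _).le

end IsMomentBasis

theorem ansatz_eq (α : EuclideanSpace ℝ (Fin (N + 1))) (v : EuclideanSpace ℝ (Fin d)) :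
    ansatz η m α v = deriv (legendreDual η) (inner ℝ (basisVec m v) α) := by
  rw [inner_basisVec, ansatz]

theorem integrable_ansatz_smul {W : Type} [NormedAddCommGroup W] [NormedSpace ℝ W]
    (hm : IsMomentBasis V m) (hη : IsSuperlinearEntropy η)
    {a : EuclideanSpace ℝ (Fin d) → W} {L : ℝ}
    (ha : AEStronglyMeasurable a (volume.restrict V))
    (haL : ∀ᵐ v ∂(volume.restrict V), ‖a v‖ ≤ L) (α : EuclideanSpace ℝ (Fin (N + 1))) :
    Integrable (fun v => ansatz η m α v • a v) (volume.restrict V) := by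
  have := hm.isFiniteMeasure
  simp only [ansatz_eq]
  exact integrable_inner_smul hm.aestronglyMeasurable_basisVec hm.norm_basisVec_le ha haL
    hη.legendreDual_spec.2.1.continuous α

theorem integrable_ansatz (hm : IsMomentBasis V m) (hη : IsSuperlinearEntropy η)
    (α : EuclideanSpace ℝ (Fin (N + 1))) :
    Integrable (fun v => ansatz η m α v) (volume.restrict V) := by
  simpa using integrable_ansatz_smul hm hη (a := fun _ => (1 : ℝ)) (L := 1)
    aestronglyMeasurable_const (by simp) α

/-- The potential `Ψ(α) = ⟨η_*(α · m)⟩`. -/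
noncomputable def momentPotential (η : ℝ → ℝ) (V : Set (EuclideanSpace ℝ (Fin d)))
    (m : Fin (N + 1) → EuclideanSpace ℝ (Fin d) → ℝ) (α : EuclideanSpace ℝ (Fin (N + 1))) : ℝ :=
  ∫ v in V, legendreDual η (∑ i, α i * m i v)

/-- The flux `⟨v m G_α⟩` as a function of the multiplier. -/
noncomputable def multiplierFlux (η : ℝ → ℝ) (V : Set (EuclideanSpace ℝ (Fin d)))
    (m : Fin (N + 1) → EuclideanSpace ℝ (Fin d) → ℝ) (α : EuclideanSpace ℝ (Fin (N + 1))) :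
    EuclideanSpace ℝ (Fin d × Fin (N + 1)) :=
  ∫ v in V, ansatz η m α v • fluxVec m v

theorem momentMap_eq_integral (hm : IsMomentBasis V m) (hη : IsSuperlinearEntropy η)
    (α : EuclideanSpace ℝ (Fin (N + 1))) :
    momentMap η V m α = ∫ v in V, ansatz η m α v • basisVec m v := by
  ext i
  rw [ofLp_integral (integrable_ansatz_smul hm hη hm.aestronglyMeasurable_basisVec
    hm.norm_basisVec_le α)]
  simp [momentMap, basisVec, mul_comm]

theorem flux_eq (hm : IsMomentBasis V m) (hη : IsSuperlinearEntropy η) (γ : ℝ) :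
    flux η V m γ = fun u => multiplierFlux η V m (multiplier η V m γ u) := by
  funext u
  obtain ⟨L, -, hL⟩ := hm.exists_norm_fluxVec_le
  ext p
  rw [multiplierFlux, ofLp_integral (integrable_ansatz_smul hm hη hm.aestronglyMeasurable_fluxVec
    hL _)]
  simp [flux, fluxVec, mul_comm]

theorem contDiff_integral_ansatz_smul {W : Type} [NormedAddCommGroup W] [NormedSpace ℝ W]
    (hm : IsMomentBasis V m) (hη : IsSuperlinearEntropy η)
    {a : EuclideanSpace ℝ (Fin d) → W} {L : ℝ}
    (ha : AEStronglyMeasurable a (volume.restrict V))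
    (haL : ∀ᵐ v ∂(volume.restrict V), ‖a v‖ ≤ L) :
    ContDiff ℝ 2 fun α => ∫ v in V, ansatz η m α v • a v := by
  have := hm.isFiniteMeasure
  simp only [ansatz_eq]
  exact contDiff_integral_inner_smul hm.aestronglyMeasurable_basisVec hm.norm_basisVec_le 2 ha haL
    hη.legendreDual_spec.2.1

theorem contDiff_multiplierFlux (hm : IsMomentBasis V m) (hη : IsSuperlinearEntropy η) :
    ContDiff ℝ 2 (multiplierFlux η V m) := by
  obtain ⟨L, -, hL⟩ := hm.exists_norm_fluxVec_le
  exact contDiff_integral_ansatz_smul hm hη hm.aestronglyMeasurable_fluxVec hL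

theorem hasFDerivAt_momentPotential (hm : IsMomentBasis V m) (hη : IsSuperlinearEntropy η)
    (α : EuclideanSpace ℝ (Fin (N + 1))) :
    HasFDerivAt (momentPotential η V m) (innerSL ℝ (momentMap η V m α)) α := by
  have := hm.isFiniteMeasure
  obtain ⟨hφ, hg, -⟩ := hη.legendreDual_spec
  have hc := hm.aestronglyMeasurable_basisVec
  have hcK := hm.norm_basisVec_le
  have h1 : AEStronglyMeasurable (fun _ => (1 : ℝ)) (volume.restrict V) :=
    aestronglyMeasurable_const
  have h1b : ∀ᵐ _v ∂(volume.restrict V), ‖(1 : ℝ)‖ ≤ 1 := by simp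
  have hφ1 : ContDiff ℝ 1 (legendreDual η) := contDiff_one_iff_deriv.2 ⟨hφ, hg.continuous⟩
  have h := hasFDerivAt_integral_inner_smul hc hcK h1 h1b hφ1 α
  have hΨ : momentPotential η V m = fun α =>
      ∫ v in V, legendreDual η (inner ℝ (basisVec m v) α) • (1 : ℝ) := by
    funext α
    simp [momentPotential, inner_basisVec]
  rw [hΨ]
  refine h.congr_fderiv ?_
  ext δ
  have hint := integrable_inner_smul hc hcK (aestronglyMeasurable_weightDeriv hc h1)
    (norm_weightDeriv_le hcK h1b) hg.continuous α
  rw [ContinuousLinearMap.integral_apply hint, innerSL_apply_apply, momentMap_eq_integral hm hη,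
    real_inner_comm, ← integral_inner (integrable_ansatz_smul hm hη hc hcK α)]
  refine integral_congr_ae (Filter.Eventually.of_forall fun v => ?_)
  simp [weightDeriv, ansatz_eq, inner_smul_right, real_inner_comm]

/-- The Hessian form is `⟨η_*''(α · m) (m · δ)²⟩`; if it vanished, `m · δ = 0` a.e., against linear
independence. -/
theorem isConvexPotential_momentPotential (hm : IsMomentBasis V m)
    (hη : IsSuperlinearEntropy η) :
    IsConvexPotential (momentPotential η V m) (momentMap η V m) := by
  have := hm.isFiniteMeasure
  obtain ⟨-, hg, -, hg', -⟩ := hη.legendreDual_spec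
  have hc := hm.aestronglyMeasurable_basisVec
  have hcK := hm.norm_basisVec_le
  have hU : momentMap η V m = fun α => ∫ v in V, ansatz η m α v • basisVec m v :=
    funext (momentMap_eq_integral hm hη)
  refine ⟨hasFDerivAt_momentPotential hm hη, ?_, fun α δ hδ => ?_⟩
  · rw [hU]
    exact contDiff_integral_ansatz_smul hm hη hc hcK
  have hg1 : ContDiff ℝ 1 (deriv (legendreDual η)) := hg.of_le (by norm_num)
  have hg1c : Continuous (deriv (deriv (legendreDual η))) := hg1.continuous_deriv le_rfl
  have h := hasFDerivAt_integral_inner_smul hc hcK hc hcK hg1 α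
  simp only [← ansatz_eq] at h
  rw [← hU] at h
  have hi := integrable_inner_smul hc hcK (aestronglyMeasurable_weightDeriv hc hc)
    (norm_weightDeriv_le hcK hcK) hg1c α
  have hi2 := hi.apply_continuousLinearMap δ
  have hw : ∀ v, inner ℝ δ ((deriv (deriv (legendreDual η)) (inner ℝ (basisVec m v) α) •
      weightDeriv (basisVec m) (basisVec m) v) δ) =
      deriv (deriv (legendreDual η)) (inner ℝ (basisVec m v) α) *
        inner ℝ (basisVec m v) δ ^ 2 := fun v => by
    simp only [smul_apply, weightDeriv, ContinuousLinearMap.smulRight_apply, innerSL_apply_apply,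
      inner_smul_right]
    rw [real_inner_comm (basisVec m v) δ, sq]
  have key : inner ℝ (fderiv ℝ (momentMap η V m) α δ) δ =
      ∫ v in V, deriv (deriv (legendreDual η)) (inner ℝ (basisVec m v) α) *
        inner ℝ (basisVec m v) δ ^ 2 := by
    rw [h.fderiv, ContinuousLinearMap.integral_apply hi, real_inner_comm, ← integral_inner hi2]
    exact integral_congr_ae (Filter.Eventually.of_forall hw)
  have hi3 : Integrable (fun v => deriv (deriv (legendreDual η)) (inner ℝ (basisVec m v) α) *
      inner ℝ (basisVec m v) δ ^ 2) (volume.restrict V) :=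
    (hi2.const_inner δ).congr (Filter.Eventually.of_forall hw)
  have hnn : ∀ v, 0 ≤ deriv (deriv (legendreDual η)) (inner ℝ (basisVec m v) α) *
      inner ℝ (basisVec m v) δ ^ 2 := fun v => mul_nonneg (hg' _).le (sq_nonneg _)
  rw [key]
  refine lt_of_le_of_ne (integral_nonneg hnn) fun h0 => hδ ?_
  have h1 := (integral_eq_zero_iff_of_nonneg hnn hi3).1 h0.symm
  have h2 := hm.linearIndependent δ (by
    filter_upwards [h1] with v hv
    have h3 := (mul_eq_zero.1 hv).resolve_left (hg' _).ne'
    rw [← inner_basisVec]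
    exact pow_eq_zero_iff two_ne_zero |>.1 h3)
  ext i
  exact congrFun h2 i

/-- The ansatz is positive and `m 0 = 1`, so pairing the moments with the zeroth unit vector gives
the `L¹` norm of the ansatz. -/
theorem norm_integral_ansatz_smul_le {W : Type} [NormedAddCommGroup W] [NormedSpace ℝ W]
    (hm : IsMomentBasis V m) (hη : IsSuperlinearEntropy η)
    {a : EuclideanSpace ℝ (Fin d) → W} {L : ℝ}
    (haL : ∀ᵐ v ∂(volume.restrict V), ‖a v‖ ≤ L) (α : EuclideanSpace ℝ (Fin (N + 1))) :
    ‖∫ v in V, ansatz η m α v • a v‖ ≤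
      L * inner ℝ (momentMap η V m α) (EuclideanSpace.single 0 1) := by
  have h1 : inner ℝ (momentMap η V m α) (EuclideanSpace.single 0 1) =
      ∫ v in V, ansatz η m α v := by
    rw [EuclideanSpace.inner_single_right]
    simp only [momentMap, one_mul, conj_trivial]
    refine integral_congr_ae ?_
    filter_upwards [hm.zero_eq_one] with v hv
    rw [hv, one_mul]
  rw [h1, ← integral_const_mul]
  refine norm_integral_le_of_norm_le ((integrable_ansatz hm hη α).const_mul L) ?_
  filter_upwards [haL] with v hv
  have hpos : 0 < ansatz η m α v := hη.legendreDual_spec.2.2.1 _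
  rw [norm_smul, Real.norm_of_nonneg hpos.le, mul_comm]
  gcongr

theorem exists_estimateData (hm : IsMomentBasis V m) (hη : IsSuperlinearEntropy η) (M : ℝ) :
    ∃ l L K D, EstimateData (momentPotential η V m) (momentMap η V m) (multiplierFlux η V m)
      (EuclideanSpace.single 0 1) M l L K D := by
  have hp := isConvexPotential_momentPotential hm hη
  obtain ⟨l, hl, hc⟩ := hp.exists_coercive (M + 1)
  obtain ⟨L1, hL1⟩ := ContDiff.exists_taylorBound hp.contDiff (M + 1)
  obtain ⟨L2, hL2⟩ := ContDiff.exists_taylorBound (contDiff_multiplierFlux hm hη) (M + 1)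
  obtain ⟨K, hK, hF⟩ := hm.exists_norm_fluxVec_le
  have hcont : Continuous (momentPotential η V m) :=
    continuous_iff_continuousAt.2 fun α => (hp.hasFDerivAt α).continuousAt
  have hcont' : Continuous fun α => momentPotential η V m (α + EuclideanSpace.single 0 1) -
      momentPotential η V m α := by fun_prop
  obtain ⟨D, hD⟩ := (isCompact_closedBall (0 : EuclideanSpace ℝ (Fin (N + 1)))
    M).exists_bound_of_continuousOn hcont'.continuousOn
  refine ⟨l, max L1 L2, max (N + 1) K, max 0 D, hp, hl, le_max_of_le_right hK, hc,
    hL1.mono (le_max_left _ _), hL2.mono (le_max_right _ _), fun β => ?_, fun β => ?_,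
    le_max_left _ _, fun α hα => ?_⟩
  · nth_rw 1 [momentMap_eq_integral hm hη]
    exact norm_integral_ansatz_smul_le hm hη
      (hm.norm_basisVec_le.mono fun v hv => hv.trans (le_max_left _ _)) β
  · exact norm_integral_ansatz_smul_le hm hη (hF.mono fun v hv => hv.trans (le_max_right _ _)) β
  · exact (le_abs_self _).trans ((hD α (mem_closedBall_zero_iff.2 hα)).trans (le_max_right _ _))

end Moments

/-! ### Transfer to the entropy, the flux and the flux defect -/

section Main

variable {d N : ℕ} {η : ℝ → ℝ} {V : Set (EuclideanSpace ℝ (Fin d))}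
  {m : Fin (N + 1) → EuclideanSpace ℝ (Fin d) → ℝ}

theorem dualObjective_eq (γ : ℝ) (u : EuclideanSpace ℝ (Fin (N + 1))) :
    dualObjective η V m γ u = potentialObjective (momentPotential η V m) γ u := by
  funext α
  simp [dualObjective, potentialObjective, momentPotential, PiLp.inner_apply, mul_comm]

theorem isMultiplier_of_add_smul_eq (hm : IsMomentBasis V m) (hη : IsSuperlinearEntropy η)
    {γ : ℝ} (hγ : 0 ≤ γ) {u α : EuclideanSpace ℝ (Fin (N + 1))}
    (hα : momentMap η V m α + γ • α = u) : IsMultiplier η V m γ u α := by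
  rw [IsMultiplier, dualObjective_eq]
  exact (isConvexPotential_momentPotential hm hη).isMaxOn_of_add_smul_eq hγ hα

theorem IsMultiplier.eq (hm : IsMomentBasis V m) (hη : IsSuperlinearEntropy η)
    {γ : ℝ} (hγ : 0 ≤ γ) {u α β : EuclideanSpace ℝ (Fin (N + 1))}
    (hα : momentMap η V m α + γ • α = u) (hβ : IsMultiplier η V m γ u β) : β = α := by
  rw [IsMultiplier, dualObjective_eq] at hβ
  exact (isConvexPotential_momentPotential hm hη).eq_of_isMaxOn hγ hα hβ

theorem existsUnique_isMultiplier (hm : IsMomentBasis V m) (hη : IsSuperlinearEntropy η)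
    {γ : ℝ} (hγ : 0 ≤ γ) {u α : EuclideanSpace ℝ (Fin (N + 1))}
    (hα : momentMap η V m α + γ • α = u) : ∃! α, IsMultiplier η V m γ u α :=
  ⟨α, isMultiplier_of_add_smul_eq hm hη hγ hα, fun _ hβ => hβ.eq hm hη hγ hα⟩

theorem exists_add_smul_eq (hm : IsMomentBasis V m) (hη : IsSuperlinearEntropy η)
    {γ : ℝ} (hγ : 0 < γ) (u : EuclideanSpace ℝ (Fin (N + 1))) :
    ∃ α, momentMap η V m α + γ • α = u := by
  have hp := isConvexPotential_momentPotential hm hη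
  obtain ⟨α, hα⟩ := hp.exists_isMaxOn_potentialObjective hγ u
  exact ⟨α, hp.add_smul_eq_of_isMaxOn hα⟩

theorem multiplier_apply (hm : IsMomentBasis V m) (hη : IsSuperlinearEntropy η)
    {γ : ℝ} (hγ : 0 ≤ γ) (α : EuclideanSpace ℝ (Fin (N + 1))) :
    multiplier η V m γ (momentMap η V m α + γ • α) = α :=
  IsMultiplier.eq hm hη hγ rfl
    (Classical.epsilon_spec ⟨α, isMultiplier_of_add_smul_eq hm hη hγ rfl⟩)

theorem momentMap_multiplier_add (hm : IsMomentBasis V m) (hη : IsSuperlinearEntropy η)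
    {γ : ℝ} (hγ : 0 < γ) (u : EuclideanSpace ℝ (Fin (N + 1))) :
    momentMap η V m (multiplier η V m γ u) + γ • multiplier η V m γ u = u := by
  obtain ⟨α, rfl⟩ := exists_add_smul_eq hm hη hγ u
  rw [multiplier_apply hm hη hγ.le]

/-- The entropy of the ansatz is given by Fenchel's identity. -/
theorem integral_entropy_ansatz (hm : IsMomentBasis V m) (hη : IsSuperlinearEntropy η)
    (α : EuclideanSpace ℝ (Fin (N + 1))) :
    ∫ v in V, η (ansatz η m α v) =
      inner ℝ α (momentMap η V m α) - momentPotential η V m α := by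
  have := hm.isFiniteMeasure
  have hint := integrable_ansatz_smul hm hη hm.aestronglyMeasurable_basisVec
    hm.norm_basisVec_le α
  have hφ : Integrable (fun v => legendreDual η (∑ i, α i * m i v)) (volume.restrict V) := by
    have := integrable_inner_smul hm.aestronglyMeasurable_basisVec hm.norm_basisVec_le
      (a := fun _ => (1 : ℝ)) (L := 1) aestronglyMeasurable_const (by simp)
      hη.legendreDual_spec.1.continuous α
    simpa [inner_basisVec] using this
  rw [momentMap_eq_integral hm hη, ← integral_inner hint, momentPotential,
    ← integral_sub (hint.const_inner α) hφ]
  refine integral_congr_ae (Filter.Eventually.of_forall fun v => ?_)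
  dsimp only
  rw [inner_smul_right, real_inner_comm, inner_basisVec, ansatz,
    hη.legendreDual_spec.2.2.2.2, mul_comm]

/-- Absence of a duality gap: stationarity turns the misfit `‖⟨m G⟩ - u‖² / (2γ)` into `γ/2 ‖α‖²`,
and Fenchel's identity does the rest. -/
theorem entropy_eq (hm : IsMomentBasis V m) (hη : IsSuperlinearEntropy η) {γ : ℝ} (hγ : 0 < γ) :
    entropy η V m γ =
      fun u => potentialObjective (momentPotential η V m) γ u (multiplier η V m γ u) := by
  funext u
  have h1 := momentMap_multiplier_add hm hη hγ u
  rw [entropy, integral_entropy_ansatz hm hη]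
  set α := multiplier η V m γ u
  have h2 : momentMap η V m α - u = -(γ • α) := by
    rw [← h1]; abel
  have h3 : inner ℝ α u = inner ℝ α (momentMap η V m α) + γ * ‖α‖ ^ 2 := by
    rw [← h1, inner_add_right, inner_smul_right, real_inner_self_eq_norm_sq]
  rw [h2, norm_neg, norm_smul, Real.norm_of_nonneg hγ.le, potentialObjective, h3]
  field_simp
  ring

theorem gradient_entropy (hm : IsMomentBasis V m) (hη : IsSuperlinearEntropy η) {γ : ℝ}
    (hγ : 0 < γ) : gradient (entropy η V m γ) = multiplier η V m γ := by
  funext u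
  rw [entropy_eq hm hη hγ]
  refine HasGradientAt.gradient ?_
  rw [hasGradientAt_iff_hasFDerivAt]
  exact (isConvexPotential_momentPotential hm hη).hasFDerivAt_value hγ.le
    (multiplier_apply hm hη hγ.le) (momentMap_multiplier_add hm hη hγ) u

theorem contDiff_entropy (hm : IsMomentBasis V m) (hη : IsSuperlinearEntropy η) {γ : ℝ}
    (hγ : 0 < γ) : ContDiff ℝ 2 (entropy η V m γ) := by
  rw [entropy_eq hm hη hγ]
  exact (isConvexPotential_momentPotential hm hη).contDiff_value hγ.le
    (multiplier_apply hm hη hγ.le) (momentMap_multiplier_add hm hη hγ)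

/-- By duality the left side is the loss, in the dual problem for `w`'s state, of using `α` in place
of the maximizer `β`. -/
theorem relEntropy_eq (hm : IsMomentBasis V m) (hη : IsSuperlinearEntropy η) {γ : ℝ}
    (hγ : 0 < γ) (α β : EuclideanSpace ℝ (Fin (N + 1))) :
    relEntropy η V m γ (momentMap η V m β + γ • β) (momentMap η V m α + γ • α) =
      bregman (momentPotential η V m) (momentMap η V m) α β + γ / 2 * ‖β - α‖ ^ 2 := by
  rw [relEntropy, entropy_eq hm hη hγ]
  simp only [multiplier_apply hm hη hγ.le]
  rw [norm_sub_rev, ← potentialObjective_sub (Ψ := momentPotential η V m)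
    (U := momentMap η V m) rfl α]
  set u := momentMap η V m α + γ • α
  set w := momentMap η V m β + γ • β
  have : ∑ i, α i * (w i - u i) = inner ℝ α w - inner ℝ α u := by
    rw [← inner_sub_right]
    simp [PiLp.inner_apply, mul_comm]
  rw [this]
  simp only [potentialObjective]
  ring

theorem exists_hasFDerivAt_multiplier_flux (hm : IsMomentBasis V m)
    (hη : IsSuperlinearEntropy η) {γ : ℝ} (hγ : 0 ≤ γ) (α : EuclideanSpace ℝ (Fin (N + 1))) :
    ∃ P, IsResolvent (fderiv ℝ (momentMap η V m) α) γ P ∧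
      HasFDerivAt (multiplier η V m γ) P (momentMap η V m α + γ • α) ∧
      HasFDerivAt (flux η V m γ) ((fderiv ℝ (multiplierFlux η V m) α).comp P)
        (momentMap η V m α + γ • α) := by
  obtain ⟨P, hP, h1, h2⟩ := (isConvexPotential_momentPotential
    hm hη).exists_hasFDerivAt_leftInverse hγ (multiplier_apply hm hη hγ) α
  refine ⟨P, ⟨h1, h2⟩, hP, ?_⟩
  rw [flux_eq hm hη]
  have hF := ((contDiff_multiplierFlux hm hη).differentiable (by norm_num) α).hasFDerivAt
  rw [← multiplier_apply hm hη hγ α] at hF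
  have := hF.comp _ hP
  rwa [multiplier_apply hm hη hγ] at this

/-- Crude entrywise bound: `d * (N + 1)` entries, each a sum of `N + 1` products. -/
theorem norm_fluxDefect_le (γ : ℝ) (w u : EuclideanSpace ℝ (Fin (N + 1))) :
    ‖fluxDefect η V m γ w u‖ ≤ (d * (N + 1) * (N + 1)) *
      (‖hessEntropy η V m γ u (w - u)‖ *
        ‖fderiv ℝ (flux η V m 0) u - fderiv ℝ (flux η V m γ) u‖) := by
  set c := ‖hessEntropy η V m γ u (w - u)‖ *
    ‖fderiv ℝ (flux η V m 0) u - fderiv ℝ (flux η V m γ) u‖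
  have key : ∀ p, ‖fluxDefect η V m γ w u p‖ ≤ (N + 1) * c := fun p => by
    have hs : ∑ _i : Fin (N + 1), c = (N + 1) * c := by simp
    rw [← hs]
    change ‖∑ i : Fin (N + 1), hessEntropy η V m γ u (w - u) i *
      ((fderiv ℝ (flux η V m 0) u - fderiv ℝ (flux η V m γ) u)
        (EuclideanSpace.single p.2 (1 : ℝ))) (p.1, i)‖ ≤ _
    refine (norm_sum_le _ _).trans (Finset.sum_le_sum fun i _ => ?_)
    rw [norm_mul]
    refine mul_le_mul (PiLp.norm_apply_le _ i) ?_ (norm_nonneg _) (norm_nonneg _)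
    refine (PiLp.norm_apply_le _ _).trans ((ContinuousLinearMap.le_opNorm _ _).trans ?_)
    simp
  refine (norm_le_sum_norm_apply _).trans ((Finset.sum_le_sum fun p _ => key p).trans ?_)
  simp only [Finset.sum_const, Finset.card_univ, Fintype.card_prod, Fintype.card_fin,
    nsmul_eq_mul]
  push_cast
  exact le_of_eq (by ring)

theorem exists_relFlux_fluxDefect_bound (hm : IsMomentBasis V m) (hη : IsSuperlinearEntropy η)
    (M γ₀ : ℝ) (hM : 0 < M) (hγ₀ : 0 < γ₀) :
    ∃ C, 0 < C ∧ ∀ w, ∀ u ∈ momentBall η V m M, ∀ γ ∈ Ioo 0 γ₀,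
      ‖relFlux η V m γ w u‖ ≤ C * relEntropy η V m γ w u ∧
      ‖fluxDefect η V m γ w u‖ ≤ C * relEntropy η V m γ w u + C * γ ^ 2 := by
  have hp := isConvexPotential_momentPotential hm hη
  obtain ⟨l, L, K, D, hE⟩ := exists_estimateData hm hη M
  obtain ⟨C, hC, hbound⟩ := hE.exists_bound γ₀ hγ₀.le
  have hl := hE.l_pos
  have hL := hE.boundU.nonneg
  set S := L * (l⁻¹ * M) * l⁻¹ + L * (l⁻¹ * ((L * (l⁻¹ * M) + 1) * l⁻¹)) with hS
  have hS0 : 0 ≤ S := by positivity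
  set T : ℝ := d * (N + 1) * (N + 1) with hT
  have hT0 : 0 ≤ T := by positivity
  refine ⟨C + T * S * C + 1, by positivity, ?_⟩
  rintro w _ ⟨α₀, hα₀, rfl⟩ γ ⟨hγ, hγγ⟩
  have hα₀ : ‖α₀‖ ≤ M := hα₀
  obtain ⟨β, rfl⟩ := exists_add_smul_eq hm hη hγ w
  -- The same state `u` has two multipliers: `α₀` for the original problem, which gives `f'(u)`, and
  -- `α` for the regularized one, which gives `f_γ'(u)` and `h_γ''(u)`.
  obtain ⟨α, hα⟩ := exists_add_smul_eq hm hη hγ (momentMap η V m α₀)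
  have hαM : ‖α‖ ≤ M := (hp.norm_le_of_add_smul_eq hγ hα).trans hα₀
  obtain ⟨P, hP, hPm, hPf⟩ := exists_hasFDerivAt_multiplier_flux hm hη hγ.le α
  obtain ⟨P₀, hP₀, -, hP₀f⟩ := exists_hasFDerivAt_multiplier_flux hm hη le_rfl α₀
  have hdiff := hE.norm_sub_resolvent_le hα₀ hαM hγ.le hα hP₀ hP
  obtain ⟨b1, b2⟩ := hbound α β γ P hαM hγ.le hγγ.le hP
  rw [zero_smul, add_zero] at hP₀f
  have hB : 0 ≤ bregman (momentPotential η V m) (momentMap η V m) α β + γ / 2 * ‖β - α‖ ^ 2 :=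
    add_nonneg (hp.bregman_nonneg α β) (by positivity)
  have hd := norm_fluxDefect_le (η := η) (V := V) (m := m) γ (momentMap η V m β + γ • β)
    (momentMap η V m α₀)
  rw [hP₀f.fderiv] at hd
  rw [← hα] at hd ⊢
  rw [hessEntropy, gradient_entropy hm hη hγ, hPm.fderiv, hPf.fderiv] at hd
  rw [relEntropy_eq hm hη hγ, relFlux, hPf.fderiv, flux_eq hm hη]
  simp only [multiplier_apply hm hη hγ.le]
  set B := bregman (momentPotential η V m) (momentMap η V m) α β + γ / 2 * ‖β - α‖ ^ 2
  have q : 0 ≤ T * S * C := by positivity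
  refine ⟨b1.trans (by gcongr; linarith), hd.trans ?_⟩
  set y := P (momentMap η V m β + γ • β - (momentMap η V m α + γ • α))
  calc T * (‖y‖ * _) ≤ T * (‖y‖ * (S * γ)) := by gcongr
    _ = T * S * (γ * ‖y‖) := by ring
    _ ≤ T * S * (C * (B + γ ^ 2)) := by gcongr
    _ = T * S * C * B + T * S * C * γ ^ 2 := by ring
    _ ≤ _ := by gcongr <;> linarith

end Main

end EntropyMoments

theorem mainTheorem6 {d N : ℕ} (V : Set (EuclideanSpace ℝ (Fin d)))
    (m : Fin (N + 1) → EuclideanSpace ℝ (Fin d) → ℝ)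
    (hm : EntropyMoments.IsMomentBasis V m)
    (η : ℝ → ℝ) (hη : EntropyMoments.IsSuperlinearEntropy η)
    (M : ℝ) (hM : 0 < M) (γ₀ : ℝ) (hγ₀ : 0 < γ₀) :
    -- the maximizers and the derivatives in the claim exist
    ((∀ γ : ℝ, 0 < γ → ∀ w : EuclideanSpace ℝ (Fin (N + 1)),
        ∃! α, EntropyMoments.IsMultiplier η V m γ w α) ∧
      ∀ u ∈ EntropyMoments.momentBall η V m M,
        (∃! α, EntropyMoments.IsMultiplier η V m 0 u α) ∧
        DifferentiableAt ℝ (EntropyMoments.flux η V m 0) u ∧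
        ∀ γ : ℝ, 0 < γ →
          DifferentiableAt ℝ (EntropyMoments.flux η V m γ) u ∧
          ContDiffAt ℝ 2 (EntropyMoments.entropy η V m γ) u) ∧
    ∃ Cf CJ DJ : ℝ, 0 < Cf ∧ 0 < CJ ∧ 0 < DJ ∧
      ∀ w : EuclideanSpace ℝ (Fin (N + 1)),
      ∀ u ∈ EntropyMoments.momentBall η V m M,
      ∀ γ ∈ Set.Ioo 0 γ₀,
        ‖EntropyMoments.relFlux η V m γ w u‖ ≤ Cf * EntropyMoments.relEntropy η V m γ w u ∧
        ‖EntropyMoments.fluxDefect η V m γ w u‖ ≤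
          CJ * EntropyMoments.relEntropy η V m γ w u + DJ * γ ^ 2 := by
  obtain ⟨C, hC, hbound⟩ := EntropyMoments.exists_relFlux_fluxDefect_bound hm hη M γ₀ hM hγ₀
  refine ⟨⟨fun γ hγ w => ?_, ?_⟩, C, C, C, hC, hC, hC, hbound⟩
  · obtain ⟨α, hα⟩ := EntropyMoments.exists_add_smul_eq hm hη hγ w
    exact EntropyMoments.existsUnique_isMultiplier hm hη hγ.le hα
  · rintro _ ⟨α₀, -, rfl⟩
    have h0 : EntropyMoments.momentMap η V m α₀ + (0 : ℝ) • α₀ =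
        EntropyMoments.momentMap η V m α₀ := by
      rw [zero_smul, add_zero]
    refine ⟨EntropyMoments.existsUnique_isMultiplier hm hη le_rfl h0, ?_, fun γ hγ => ⟨?_,
      (EntropyMoments.contDiff_entropy hm hη hγ).contDiffAt⟩⟩
    · obtain ⟨P, -, -, hP⟩ :=
        EntropyMoments.exists_hasFDerivAt_multiplier_flux hm hη le_rfl α₀
      rw [h0] at hP
      exact hP.differentiableAt
    · obtain ⟨α, hα⟩ := EntropyMoments.exists_add_smul_eq hm hη hγ
        (EntropyMoments.momentMap η V m α₀)
      obtain ⟨P, -, -, hP⟩ :=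
        EntropyMoments.exists_hasFDerivAt_multiplier_flux hm hη hγ.le α
      rw [hα] at hP
      exact hP.differentiableAt
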